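/- Let $\tau>0$. On $\mathbb R^4$ put $\langle v,w\rangle=v_1w_1+v_2w_2-v_3w_3-v_4w_4$, identify $\mathrm{SL}(2,\mathbb R)$ with $\{v\in\mathbb R^4:\langle v,v\rangle=1\}=\{(z,w)\in\mathbb C^2:|z|^2-|w|^2=1\}$, let $X_1=(iz,iw)$, $X_2=(i\bar w,i\bar z)$, $X_3=(\bar w,\bar z)$, and give $\mathrm{SL}(2,\mathbb R)$ the Riemannian metric $g_\tau(X,Y)=-\langle X,Y\rangle+(1+\tau^2)\langle X,X_1\rangle\langle Y,X_1\rangle$, with orthonormal frame $E_1=-\tau^{-1}X_1$, $E_2=X_2$, $E_3=X_3$, Levi-Civita connection $\nabla$ and curvature $R(X,Y)Z=\nabla_X\nabla_YZ-\nabla_Y\nabla_XZ-\nabla_{[X,Y]}Z$. Let $J_1$ be multiplication by $i$ on $\mathbb C^2=\mathbb R^4$ and $\mathrm O_2(4)=\{A\in\mathrm{GL}(4,\mathbb R):A^t=\epsilon A^{-1}\epsilon\}$, $\epsilon=\mathrm{diag}(1,1,-1,-1)$. **Theorem.** Let $I\subset\mathbb R$ be a nonempty open interval and $\gamma:I\to(\mathrm{SL}(2,\mathbb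 R),g_\tau)$ a smooth curve parametrized by arc length which is proper biharmonic, i.e. with $T=\gamma'$ it satisfies $\nabla_T^3T-R(T,\nabla_TT)T=0$ and is not a geodesic ($\nabla_TT\not\equiv0$). Suppose $\gamma$ is oriented so that $g_\tau(\gamma',E_1)\ge 0$. Then there are $\vartheta\in(0,\pi/2]$, a smooth function $\beta:I\to\mathbb R$ and a constant $b$ such that on $I$ $$\gamma'=\cos\vartheta\,E_1+\sin\vartheta\sin\beta\,E_2+\sin\vartheta\cos\beta\,E_3,\qquad \beta'=b .$$ For any such $\vartheta,\beta,b$ put $$a=\tfrac12\big(-\tau^{-2}+1-(1+\tau^{-2})\cos2\vartheta\big)-\tau^{-1}b\cos\vartheta .$$ If $b^2>4a$, then one of the following holds: (i) $b=-\tau^{-1}(2+\tau^2)\cos\vartheta+\sqrt{(4+5\tau^2)\cos^2\vartheta-4(1+\tau^2)}$ and $\dfrac{4(1+\tau^2)}{4+5\tau^2}\le\cos^2\vartheta<\dfrac{(2+\tau^2)^2}{4+5\tau^2+\tau^4}$; (ii) $b=-\tau^{-1}(2+\tau^2)\cos\vartheta-\sqrt{(4+5\tau^2)\cos^2\vartheta-4(1+\tau^2)}$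 and $\dfrac{4(1+\tau^2)}{4+5\tau^2}\le\cos^2\vartheta$. In both cases, with $$\alpha_{1,2}=\sqrt{\frac{(b^2-2a)\pm\sqrt{b^2(b^2-4a)}}{2}},\quad \tilde B=(1+\tau^{-2})\cos^2\vartheta-1,\quad C_{11}=\frac{\tilde B-\alpha_2^2}{\alpha_1^2-\alpha_2^2},\quad C_{33}=\frac{-\tilde B+\alpha_1^2}{\alpha_1^2-\alpha_2^2},$$ one has $0<\alpha_2<\alpha_1$ and $C_{11}<0<C_{33}$, and there is $A\in\mathrm O_2(4)$ with $AJ_1=-J_1A$ such that for all $s\in I$ $$\gamma(s)=A\big(\sqrt{C_{33}}\cos(\alpha_2s),\ \sqrt{C_{33}}\sin(\alpha_2s),\ \sqrt{-C_{11}}\cos(\alpha_1s),\ \sqrt{-C_{11}}\sin(\alpha_1s)\big).$$ -/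

import Mathlib

open scoped ContDiff Matrix

noncomputable section

namespace SLTwo

/-- The coordinate space `ℝ⁴`; `(z, w) ∈ ℂ²` is `(v₀ + i v₁, v₂ + i v₃)`. -/
abbrev Vec4 : Type := Fin 4 → ℝ

/-- The inner product of signature `(2,2)` on `ℝ⁴`. -/
def inner22 (v w : Vec4) : ℝ := v 0 * w 0 + v 1 * w 1 - v 2 * w 2 - v 3 * w 3

/-- `SL(2,ℝ)` as the quadric `⟨v, v⟩ = 1` (that is, `|z|² - |w|² = 1`). -/
def SL2R : Set Vec4 := {v | inner22 v v = 1}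

/-- The Hopf vector field `X₁(z,w) = (iz, iw)`. -/
def X1 (p : Vec4) : Vec4 := ![-p 1, p 0, -p 3, p 2]

/-- `X₂(z,w) = (i w̄, i z̄)`. -/
def X2 (p : Vec4) : Vec4 := ![p 3, p 2, p 1, p 0]

/-- `X₃(z,w) = (w̄, z̄)`. -/
def X3 (p : Vec4) : Vec4 := ![p 2, -p 3, p 0, -p 1]

/-- The metric `g_τ` at the point `p`, on vectors tangent to `SL(2,ℝ)` at `p`. -/
def metric (τ : ℝ) (p v w : Vec4) : ℝ :=
  -inner22 v w + (1 + τ ^ 2) * inner22 v (X1 p) * inner22 w (X1 p)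

/-- The global frame `E₁ = -τ⁻¹ X₁`, `E₂ = X₂`, `E₃ = X₃` (indexed by `0, 1, 2`). -/
def frame (τ : ℝ) (i : Fin 3) (p : Vec4) : Vec4 :=
  (![-τ⁻¹ • X1 p, X2 p, X3 p] : Fin 3 → Vec4) i

/-- The vector field with constant coefficients `x` in the frame. -/
def field (τ : ℝ) (x : Fin 3 → ℝ) (p : Vec4) : Vec4 := ∑ i, x i • frame τ i p

/-- Coefficients in the frame of a vector tangent at `p ∈ SL(2,ℝ)`. -/
def coords (τ : ℝ) (p v : Vec4) : Fin 3 → ℝ := fun i => metric τ p v (frame τ i p)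

/-- Coefficients of the Lie bracket of the fields with constant frame coefficients `x`, `y`. -/
def bracket (τ : ℝ) (x y : Fin 3 → ℝ) : Fin 3 → ℝ :=
  ![2 * τ * (x 1 * y 2 - x 2 * y 1),
    2 * τ⁻¹ * (x 0 * y 2 - x 2 * y 0),
    -(2 * τ⁻¹ * (x 0 * y 1 - x 1 * y 0))]

/-- The Levi-Civita connection of `g_τ`: coefficients of `∇_X Y` for the fields `X`, `Y` with
constant frame coefficients `x`, `y`. -/
def conn (τ : ℝ) (x y : Fin 3 → ℝ) : Fin 3 → ℝ :=
  ![τ * (x 1 * y 2 - x 2 * y 1),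
    τ⁻¹ * (2 + τ ^ 2) * (x 0 * y 2) + τ * (x 2 * y 0),
    -(τ⁻¹ * (2 + τ ^ 2) * (x 0 * y 1)) - τ * (x 1 * y 0)]

/-- Frame coefficients of `R(X,Y)Z = ∇_X ∇_Y Z - ∇_Y ∇_X Z - ∇_[X,Y] Z`. -/
def curv (τ : ℝ) (x y z : Fin 3 → ℝ) : Fin 3 → ℝ :=
  conn τ x (conn τ y z) - conn τ y (conn τ x z) - conn τ (bracket τ x y) z

theorem frame_tangent (τ : ℝ) (i : Fin 3) (p : Vec4) : inner22 (frame τ i p) p = 0 := by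
  fin_cases i <;> simp [frame, inner22, X1, X2, X3] <;> ring

theorem frame_orthonormal {τ : ℝ} (hτ : 0 < τ) {p : Vec4} (hp : p ∈ SL2R) (i j : Fin 3) :
    metric τ p (frame τ i p) (frame τ j p) = if i = j then 1 else 0 := by
  have h : p 0 * p 0 + p 1 * p 1 - p 2 * p 2 - p 3 * p 3 = 1 := hp
  have hX : inner22 (X1 p) (X1 p) = 1 := by
    simp only [inner22, X1, Matrix.cons_val]; linarith
  have hX2 : inner22 (X2 p) (X2 p) = -1 := by
    simp only [inner22, X2, Matrix.cons_val]; linarith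
  have hX3 : inner22 (X3 p) (X3 p) = -1 := by
    simp only [inner22, X3, Matrix.cons_val]; linarith
  have h12 : inner22 (X1 p) (X2 p) = 0 := by
    simp only [inner22, X1, X2, Matrix.cons_val]; ring
  have h13 : inner22 (X1 p) (X3 p) = 0 := by
    simp only [inner22, X1, X3, Matrix.cons_val]; ring
  have h23 : inner22 (X2 p) (X3 p) = 0 := by
    simp only [inner22, X2, X3, Matrix.cons_val]; ring
  have comm : ∀ v w, inner22 v w = inner22 w v := by intro v w; simp only [inner22]; ring
  have sl : ∀ (c : ℝ) v w, inner22 (c • v) w = c * inner22 v w := by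
    intro c v w; simp only [inner22, Pi.smul_apply, smul_eq_mul]; ring
  have sr : ∀ (c : ℝ) v w, inner22 v (c • w) = c * inner22 v w := by
    intro c v w; simp only [inner22, Pi.smul_apply, smul_eq_mul]; ring
  have nl : ∀ v w, inner22 (-v) w = -inner22 v w := by
    intro v w; simp only [inner22, Pi.neg_apply]; ring
  have nr : ∀ v w, inner22 v (-w) = -inner22 v w := by
    intro v w; simp only [inner22, Pi.neg_apply]; ring
  fin_cases i <;> fin_cases j <;>
    simp [frame, metric, sl, sr, nl, nr, hX, hX2, hX3, h12, h13, h23,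
      comm (X2 p) (X1 p), comm (X3 p) (X1 p), comm (X3 p) (X2 p),
      -Matrix.smul_cons]
  field_simp
  ring

/-- `bracket` is the Lie bracket of vector fields. -/
theorem lieBracket_field {τ : ℝ} (hτ : 0 < τ) (x y : Fin 3 → ℝ) (p : Vec4) :
    VectorField.lieBracket ℝ (field τ x) (field τ y) p = field τ (bracket τ x y) p := by
  have lin : ∀ x : Fin 3 → ℝ, ∃ L : Vec4 →ₗ[ℝ] Vec4, ∀ q, L q = field τ x q := by
    intro x
    refine ⟨⟨⟨field τ x, ?_⟩, ?_⟩, fun q => rfl⟩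
    · intro u v
      ext k
      fin_cases k <;> simp [field, frame, X1, X2, X3, Fin.sum_univ_three] <;> ring
    · intro c v
      ext k
      fin_cases k <;> simp [field, frame, X1, X2, X3, Fin.sum_univ_three] <;> ring
  obtain ⟨Lx, hLx⟩ := lin x
  obtain ⟨Ly, hLy⟩ := lin y
  have ex : field τ x = ⇑(LinearMap.toContinuousLinearMap Lx) := by
    funext q; simp [hLx]
  have ey : field τ y = ⇑(LinearMap.toContinuousLinearMap Ly) := by
    funext q; simp [hLy]
  have key : VectorField.lieBracket ℝ (field τ x) (field τ y) p
      = field τ y (field τ x p) - field τ x (field τ y p) := by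
    rw [VectorField.lieBracket]
    conv_lhs => rw [ex, ey]
    rw [ContinuousLinearMap.fderiv, ContinuousLinearMap.fderiv, ← ex, ← ey]
  rw [key]
  ext k
  fin_cases k <;>
    simp [field, frame, bracket, X1, X2, X3, Fin.sum_univ_three] <;> field_simp <;> ring

/-- The connection is torsion-free. -/
theorem conn_torsionFree {τ : ℝ} (hτ : 0 < τ) (x y : Fin 3 → ℝ) :
    conn τ x y - conn τ y x = bracket τ x y := by
  ext k
  fin_cases k <;> simp [conn, bracket] <;> field_simp <;> ring

/-- The connection is compatible with the metric (the frame is orthonormal). -/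
theorem conn_metric (τ : ℝ) (x y z : Fin 3 → ℝ) :
    ∑ i, conn τ x y i * z i + ∑ i, y i * conn τ x z i = 0 := by
  simp [conn, Fin.sum_univ_three]; ring

/-- The covariant derivative `∇^τ_{γ'} V` of a tangent vector field `V` along `γ`. -/
def covDeriv (τ : ℝ) (γ V : ℝ → Vec4) (s : ℝ) : Vec4 :=
  ∑ i, (deriv (fun t => coords τ (γ t) (V t) i) s
      + conn τ (coords τ (γ s) (deriv γ s)) (coords τ (γ s) (V s)) i) • frame τ i (γ s)

/-- The curvature `R(u,v)w` for vectors tangent at `p`. -/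
def riem (τ : ℝ) (p u v w : Vec4) : Vec4 :=
  field τ (curv τ (coords τ p u) (coords τ p v) (coords τ p w)) p

/-- The tension field `∇_T T` of a curve, `T = γ'`. -/
def tension (τ : ℝ) (γ : ℝ → Vec4) : ℝ → Vec4 := covDeriv τ γ (deriv γ)

/-- The bitension field `∇_T ∇_T (∇_T T) - R(T, ∇_T T) T` of a curve. -/
def bitension (τ : ℝ) (γ : ℝ → Vec4) (s : ℝ) : Vec4 :=
  covDeriv τ γ (covDeriv τ γ (tension τ γ)) s
    - riem τ (γ s) (deriv γ s) (tension τ γ s) (deriv γ s)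

/-- `γ` is, on the open interval `I`, a smooth proper biharmonic (biharmonic and not geodesic)
curve of `SL(2,ℝ)_τ` parametrized by arc length. -/
structure IsProperBiharmonic (τ : ℝ) (I : Set ℝ) (γ : ℝ → Vec4) : Prop where
  smooth : ContDiffOn ℝ ∞ γ I
  mem : ∀ s ∈ I, γ s ∈ SL2R
  arcLength : ∀ s ∈ I, metric τ (γ s) (deriv γ s) (deriv γ s) = 1
  biharmonic : ∀ s ∈ I, bitension τ γ s = 0
  notGeodesic : ∃ s ∈ I, tension τ γ s ≠ 0

/-- `γ` makes the constant angle `ϑ ∈ (0, π/2]` with `E₁`, the horizontal part of `γ'` has the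
smooth phase `β` with respect to `E₂`, `E₃`, and `β' = b` is constant. -/
structure IsAngleData (τ : ℝ) (I : Set ℝ) (γ : ℝ → Vec4) (ϑ b : ℝ) (β : ℝ → ℝ) : Prop where
  angle_mem : ϑ ∈ Set.Ioc 0 (Real.pi / 2)
  smooth : ContDiffOn ℝ ∞ β I
  tangent : ∀ s ∈ I, deriv γ s = Real.cos ϑ • frame τ 0 (γ s)
      + (Real.sin ϑ * Real.sin (β s)) • frame τ 1 (γ s)
      + (Real.sin ϑ * Real.cos (β s)) • frame τ 2 (γ s)
  deriv_phase : ∀ s ∈ I, deriv β s = b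

/-- The constant `a`. -/
def aConst (τ ϑ b : ℝ) : ℝ :=
  1 / 2 * (-(τ ^ 2)⁻¹ + 1 - (1 + (τ ^ 2)⁻¹) * Real.cos (2 * ϑ)) - τ⁻¹ * Real.cos ϑ * b

/-- The constant `B̃ = ⟨γ', γ'⟩`. -/
def bTilde (τ ϑ : ℝ) : ℝ := (1 + (τ ^ 2)⁻¹) * Real.cos ϑ ^ 2 - 1

def alpha1 (a b : ℝ) : ℝ := √(((b ^ 2 - 2 * a) + √(b ^ 2 * (b ^ 2 - 4 * a))) / 2)

def alpha2 (a b : ℝ) : ℝ := √(((b ^ 2 - 2 * a) - √(b ^ 2 * (b ^ 2 - 4 * a))) / 2)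

def c11 (τ ϑ a b : ℝ) : ℝ :=
  (bTilde τ ϑ - alpha2 a b ^ 2) / (alpha1 a b ^ 2 - alpha2 a b ^ 2)

def c33 (τ ϑ a b : ℝ) : ℝ :=
  (-bTilde τ ϑ + alpha1 a b ^ 2) / (alpha1 a b ^ 2 - alpha2 a b ^ 2)

/-- The complex structure `J₁ = diag(J, J)`, that is, multiplication by `i` on `ℂ²`. -/
def J1 : Matrix (Fin 4) (Fin 4) ℝ :=
  !![0, -1, 0, 0; 1, 0, 0, 0; 0, 0, 0, -1; 0, 0, 1, 0]

/-- `ε = diag(1, 1, -1, -1)`. -/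
def epsilon : Matrix (Fin 4) (Fin 4) ℝ := Matrix.diagonal ![1, 1, -1, -1]

/-- The indefinite orthogonal group `O₂(4)`. -/
def O24 : Set (Matrix (Fin 4) (Fin 4) ℝ) := {A | IsUnit A ∧ Aᵀ = epsilon * A⁻¹ * epsilon}

end SLTwo

end

noncomputable section

namespace SLTwo

/-! Write `t` for the velocity, `h = ∇_T T` and `q = ∇_T h`, all as coefficient vectors in the
orthonormal left-invariant frame; the biharmonic equation becomes `∇_T q = R(t,h)t`. Differentiating
inner products shows that `|h|² = K` is constant, expresses `|q|²` through `K` and `w = (t × h)₀`,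
and gives the derivative of the torsion `S = det(t,h,q)`. The Gram determinant yields a quadratic
relation between `S` and `w`, and differentiating it forces `h₀ = 0` (`h_zero`). Hence `t₀ = cos ϑ`
is constant and the horizontal part of `t` rotates at constant speed `b` (`exists_rotation`); the
formula for `|q|²` becomes a quadratic equation linking `b` and `cos ϑ` (`rotation_relation`).

In `ℝ⁴ = ℂ²` such a curve satisfies `γ'' = b i γ' + a γ`. The relation forces `b < 0 < a`, so when
`b² > 4a` the solutions are combinations of `e^{-iα₁s}` and `e^{-iα₂s}`, where `α₁ > α₂ > 0` are the
roots of `x² + bx + a`. The two components are orthogonal, also after multiplication by `i`, and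
have squared norms `C₁₁ < 0 < C₃₃`. The negative exponents are why the isometry `A` carrying the
model curve to `γ` is antilinear (`exists_antilinear_isometry`). -/

/-! ### Frame calculus and curvature -/

theorem field_apply (τ : ℝ) (x : Fin 3 → ℝ) (p : Vec4) :
    field τ x p = ![x 0 * (τ⁻¹ * p 1) + x 1 * p 3 + x 2 * p 2,
      -(x 0 * (τ⁻¹ * p 0)) + x 1 * p 2 - x 2 * p 3,
      x 0 * (τ⁻¹ * p 3) + x 1 * p 1 + x 2 * p 0,
      -(x 0 * (τ⁻¹ * p 2)) + x 1 * p 0 - x 2 * p 1] := by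
  ext k
  fin_cases k <;> simp [field, frame, X1, X2, X3, Fin.sum_univ_three] <;> ring

/-- Frame coefficients written out. -/
theorem coords_apply (τ : ℝ) (p v : Vec4) :
    coords τ p v = ![τ⁻¹ * inner22 v (X1 p)
        - (1 + τ ^ 2) * τ⁻¹ * inner22 v (X1 p) * inner22 (X1 p) (X1 p),
      -inner22 v (X2 p), -inner22 v (X3 p)] := by
  ext k
  fin_cases k <;> simp [coords, metric, frame, inner22, X1, X2, X3] <;>
    first | ring1 | (right; ring1)

theorem metric_add_left (τ : ℝ) (p u v w : Vec4) :
    metric τ p (u + v) w = metric τ p u w + metric τ p v w := by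
  simp [metric, inner22]; ring

theorem metric_smul_left (τ : ℝ) (p : Vec4) (c : ℝ) (v w : Vec4) :
    metric τ p (c • v) w = c * metric τ p v w := by
  simp [metric, inner22]; ring

theorem coords_field {τ : ℝ} (hτ : 0 < τ) {p : Vec4} (hp : p ∈ SL2R) (x : Fin 3 → ℝ) :
    coords τ p (field τ x p) = x := by
  ext i
  simp only [coords, field, Fin.sum_univ_three, metric_add_left, metric_smul_left,
    frame_orthonormal hτ hp]
  fin_cases i <;> simp

/-- Tangency cannot be dropped: at `p` the frame spans only the `⟨·,·⟩`-orthogonal complement of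
`p`. -/
theorem field_coords {τ : ℝ} (hτ : 0 < τ) {p : Vec4} (hp : p ∈ SL2R) {v : Vec4}
    (hv : inner22 v p = 0) : field τ (coords τ p v) p = v := by
  have h : p 0 * p 0 + p 1 * p 1 - p 2 * p 2 - p 3 * p 3 = 1 := hp
  have hX : inner22 (X1 p) (X1 p) = 1 := by
    simp only [inner22, X1, Matrix.cons_val]; linarith
  rw [field_apply, coords_apply, hX]
  have e : τ⁻¹ * τ = 1 := inv_mul_cancel₀ hτ.ne'
  have h1 : (τ⁻¹ * inner22 v (X1 p) - (1 + τ ^ 2) * τ⁻¹ * inner22 v (X1 p) * 1) * τ⁻¹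
      = -inner22 v (X1 p) := by field_simp; ring
  simp only [inner22] at hv
  ext k
  fin_cases k <;> simp only [Fin.zero_eta, Fin.mk_one, Fin.reduceFinMk, Matrix.cons_val,
    ← mul_assoc, h1] <;> simp only [inner22, X1, X2, X3, Matrix.cons_val]
  · linear_combination v 0 * h - p 0 * hv
  · linear_combination v 1 * h - p 1 * hv
  · linear_combination v 2 * h - p 2 * hv
  · linear_combination v 3 * h - p 3 * hv

theorem metric_self {τ : ℝ} (hτ : 0 < τ) {p : Vec4} (hp : p ∈ SL2R) {v : Vec4}
    (hv : inner22 v p = 0) : metric τ p v v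
      = coords τ p v 0 ^ 2 + coords τ p v 1 ^ 2 + coords τ p v 2 ^ 2 := by
  have key : ∀ x : Fin 3 → ℝ, metric τ p v (field τ x p) = ∑ i, x i * coords τ p v i := by
    intro x
    simp [coords, field, metric, inner22, Fin.sum_univ_three]; ring
  have := key (coords τ p v)
  rw [field_coords hτ hp hv] at this
  rw [this, Fin.sum_univ_three]; ring

theorem field_sub (τ : ℝ) (x y : Fin 3 → ℝ) (p : Vec4) :
    field τ (x - y) p = field τ x p - field τ y p := by
  simp only [field, Pi.sub_apply, sub_smul, Finset.sum_sub_distrib]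

theorem field_zero (τ : ℝ) (p : Vec4) : field τ 0 p = 0 := by simp [field]

/-- The curvature operator is diagonal on bivectors in the frame `E₁, E₂, E₃`. -/
theorem curv_apply {τ : ℝ} (hτ : 0 < τ) (x y z : Fin 3 → ℝ) :
    curv τ x y z = ![τ ^ 2 * (-(x 2 * y 0 - x 0 * y 2) * z 2 + (x 0 * y 1 - x 1 * y 0) * z 1),
      -(τ ^ 2 * (x 0 * y 1 - x 1 * y 0) * z 0)
        - (4 + 3 * τ ^ 2) * (x 1 * y 2 - x 2 * y 1) * z 2,
      (4 + 3 * τ ^ 2) * (x 1 * y 2 - x 2 * y 1) * z 1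
        + τ ^ 2 * (x 2 * y 0 - x 0 * y 2) * z 0] := by
  ext k
  fin_cases k <;> simp [curv, conn, bracket] <;> field_simp <;> ring

/-! ### The biharmonic equation in frame coefficients -/

/-- Frame coefficients of the velocity of a curve. -/
def velocity (τ : ℝ) (γ : ℝ → Vec4) (s : ℝ) : Fin 3 → ℝ := coords τ (γ s) (deriv γ s)

/-- The covariant derivative in frame coefficients, along a curve whose velocity has
coefficients `t`. -/
def covCoeff (τ : ℝ) (t x : ℝ → Fin 3 → ℝ) (s : ℝ) : Fin 3 → ℝ :=
  fun i => deriv (fun u => x u i) s + conn τ (t s) (x s) i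

theorem covDeriv_eq_field (τ : ℝ) (γ V : ℝ → Vec4) (s : ℝ) : covDeriv τ γ V s
    = field τ (covCoeff τ (velocity τ γ) (fun u => coords τ (γ u) (V u)) s) (γ s) := rfl

theorem covCoeff_congr {τ : ℝ} {I : Set ℝ} (hI : IsOpen I) {t x y : ℝ → Fin 3 → ℝ}
    (hxy : ∀ s ∈ I, x s = y s) {s : ℝ} (hs : s ∈ I) : covCoeff τ t x s = covCoeff τ t y s := by
  ext i
  have : (fun u => x u i) =ᶠ[nhds s] fun u => y u i := by
    filter_upwards [hI.mem_nhds hs] with u hu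
    rw [hxy u hu]
  simp only [covCoeff, this.deriv_eq, hxy s hs]

theorem contDiffOn_covCoeff {τ : ℝ} {I : Set ℝ} (hI : IsOpen I) {t x : ℝ → Fin 3 → ℝ}
    (ht : ∀ i, ContDiffOn ℝ ∞ (fun s => t s i) I) (hx : ∀ i, ContDiffOn ℝ ∞ (fun s => x s i) I)
    (i : Fin 3) : ContDiffOn ℝ ∞ (fun s => covCoeff τ t x s i) I := by
  refine ContDiffOn.add ((hx i).deriv_of_isOpen hI (by simp)) ?_
  have h0 := ht 0; have h1 := ht 1; have h2 := ht 2
  have k0 := hx 0; have k1 := hx 1; have k2 := hx 2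
  fin_cases i <;> simp only [conn, Fin.zero_eta, Fin.mk_one, Fin.reduceFinMk, Matrix.cons_val] <;>
    fun_prop

theorem hasDerivAt_of_covCoeff {τ : ℝ} {I : Set ℝ} (hI : IsOpen I) {t x : ℝ → Fin 3 → ℝ}
    (hx : ∀ i, ContDiffOn ℝ ∞ (fun s => x s i) I) {s : ℝ} (hs : s ∈ I) (i : Fin 3) :
    HasDerivAt (fun u => x u i) (covCoeff τ t x s i - conn τ (t s) (x s) i) s := by
  have : DifferentiableAt ℝ (fun u => x u i) s :=
    ((hx i).contDiffAt (hI.mem_nhds hs)).differentiableAt (by simp)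
  simpa [covCoeff] using this.hasDerivAt

namespace IsProperBiharmonic

variable {τ : ℝ} {I : Set ℝ} {γ : ℝ → Vec4}

theorem hasDerivAt (hγ : IsProperBiharmonic τ I γ) (hI : IsOpen I) {s : ℝ} (hs : s ∈ I) :
    HasDerivAt γ (deriv γ s) s :=
  ((hγ.smooth.contDiffAt (hI.mem_nhds hs)).differentiableAt (by simp)).hasDerivAt

theorem hasDerivAt_apply (hγ : IsProperBiharmonic τ I γ) (hI : IsOpen I) {s : ℝ} (hs : s ∈ I)
    (k : Fin 4) : HasDerivAt (fun u => γ u k) (deriv γ s k) s :=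
  hasDerivAt_pi.1 (hγ.hasDerivAt hI hs) k

theorem inner_deriv (hγ : IsProperBiharmonic τ I γ) (hI : IsOpen I) {s : ℝ} (hs : s ∈ I) :
    inner22 (deriv γ s) (γ s) = 0 := by
  have h := fun k => hγ.hasDerivAt_apply hI hs k
  have h1 := (((h 0).mul (h 0)).add ((h 1).mul (h 1))).sub ((h 2).mul (h 2)) |>.sub
    ((h 3).mul (h 3))
  have h2 : HasDerivAt (fun _ : ℝ => (1 : ℝ)) _ s := h1.congr_of_eventuallyEq (by
    filter_upwards [hI.mem_nhds hs] with u hu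
    exact (hγ.mem u hu).symm)
  have := h2.unique (hasDerivAt_const s 1)
  simp only [inner22]
  linarith

theorem contDiffOn_velocity (hγ : IsProperBiharmonic τ I γ) (hI : IsOpen I) (i : Fin 3) :
    ContDiffOn ℝ ∞ (fun s => velocity τ γ s i) I := by
  have h : ∀ k, ContDiffOn ℝ ∞ (fun s => γ s k) I := contDiffOn_pi.1 hγ.smooth
  have h' : ∀ k, ContDiffOn ℝ ∞ (fun s => deriv γ s k) I :=
    contDiffOn_pi.1 (hγ.smooth.deriv_of_isOpen hI (by simp))
  have a0 := h 0; have a1 := h 1; have a2 := h 2; have a3 := h 3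
  have b0 := h' 0; have b1 := h' 1; have b2 := h' 2; have b3 := h' 3
  simp only [velocity, coords_apply]
  fin_cases i <;> simp only [inner22, X1, X2, X3, Fin.zero_eta, Fin.mk_one, Fin.reduceFinMk,
    Matrix.cons_val] <;> fun_prop

/-- The velocity of the curve in the frame. -/
theorem field_velocity (hγ : IsProperBiharmonic τ I γ) (hτ : 0 < τ) (hI : IsOpen I) {s : ℝ}
    (hs : s ∈ I) : field τ (velocity τ γ s) (γ s) = deriv γ s :=
  field_coords hτ (hγ.mem s hs) (hγ.inner_deriv hI hs)

theorem velocity_norm (hγ : IsProperBiharmonic τ I γ) (hτ : 0 < τ) (hI : IsOpen I) {s : ℝ}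
    (hs : s ∈ I) : velocity τ γ s 0 ^ 2 + velocity τ γ s 1 ^ 2 + velocity τ γ s 2 ^ 2 = 1 := by
  rw [← hγ.arcLength s hs, metric_self hτ (hγ.mem s hs) (hγ.inner_deriv hI hs)]; rfl

theorem coords_tension (hγ : IsProperBiharmonic τ I γ) (hτ : 0 < τ) {s : ℝ} (hs : s ∈ I) :
    coords τ (γ s) (tension τ γ s) = covCoeff τ (velocity τ γ) (velocity τ γ) s := by
  rw [tension, covDeriv_eq_field, coords_field hτ (hγ.mem s hs)]; rfl

theorem exists_tension_ne (hγ : IsProperBiharmonic τ I γ) :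
    ∃ s ∈ I, covCoeff τ (velocity τ γ) (velocity τ γ) s ≠ 0 := by
  obtain ⟨s, hs, h⟩ := hγ.notGeodesic
  refine ⟨s, hs, fun h0 => h ?_⟩
  rw [tension, covDeriv_eq_field]
  exact (congrArg (fun x => field τ x (γ s)) h0).trans (field_zero _ _)

/-- The biharmonic equation in frame coefficients. -/
theorem bitension_coeff (hγ : IsProperBiharmonic τ I γ) (hτ : 0 < τ) (hI : IsOpen I) {s : ℝ}
    (hs : s ∈ I) :
    covCoeff τ (velocity τ γ) (covCoeff τ (velocity τ γ)
        (covCoeff τ (velocity τ γ) (velocity τ γ))) s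
      = curv τ (velocity τ γ s) (covCoeff τ (velocity τ γ) (velocity τ γ) s)
        (velocity τ γ s) := by
  -- The equality is needed on all of `I`, not only at `s`, because the outer covariant derivative
  -- differentiates it.
  have h2 : ∀ u ∈ I, coords τ (γ u) (covDeriv τ γ (tension τ γ) u)
      = covCoeff τ (velocity τ γ) (covCoeff τ (velocity τ γ) (velocity τ γ)) u := by
    intro u hu
    rw [covDeriv_eq_field, coords_field hτ (hγ.mem u hu)]
    exact covCoeff_congr hI (fun v hv => hγ.coords_tension hτ hv) hu
  have h := hγ.biharmonic s hs
  rw [bitension, covDeriv_eq_field, covCoeff_congr hI h2 hs, riem, ← field_sub,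
    hγ.coords_tension hτ hs] at h
  have := congrArg (coords τ (γ s)) h
  rw [coords_field hτ (hγ.mem s hs), ← field_zero τ (γ s), coords_field hτ (hγ.mem s hs)] at this
  exact sub_eq_zero.1 this

end IsProperBiharmonic

/-! ### Scalar consequences of the biharmonic equation -/

/-- The device for differentiating an identity that holds throughout `I`; each scalar relation below
produces the next one this way. -/
theorem hasDerivAt_eq_zero {I : Set ℝ} (hI : IsOpen I) {f : ℝ → ℝ} {c f' s : ℝ} (hs : s ∈ I)
    (hf : ∀ u ∈ I, f u = c) (h : HasDerivAt f f' s) : f' = 0 :=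
  (h.congr_of_eventuallyEq (f := f) (f₁ := fun _ => c) (by
    filter_upwards [hI.mem_nhds hs] with u hu
    exact (hf u hu).symm)).unique (hasDerivAt_const s c)

theorem exists_eq_of_hasDerivAt_zero {I : Set ℝ} (hI : IsOpen I) (hc : IsConnected I)
    {f : ℝ → ℝ} (h : ∀ s ∈ I, HasDerivAt f 0 s) : ∃ c, ∀ s ∈ I, f s = c :=
  hI.exists_is_const_of_deriv_eq_zero hc.isPreconnected
    (fun s hs => (h s hs).differentiableAt.differentiableWithinAt)
    (fun s hs => (h s hs).deriv)

/-- Frame coefficients `t`, `h`, `q` of the velocity, the tension field and its covariant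
derivative along a biharmonic curve parametrized by arc length. -/
structure IsBiharmonicFrame (τ : ℝ) (I : Set ℝ) (t h q : ℝ → Fin 3 → ℝ) : Prop where
  norm : ∀ s ∈ I, t s 0 ^ 2 + t s 1 ^ 2 + t s 2 ^ 2 = 1
  deriv_t : ∀ s ∈ I, ∀ i, HasDerivAt (fun u => t u i) (h s i - conn τ (t s) (t s) i) s
  deriv_h : ∀ s ∈ I, ∀ i, HasDerivAt (fun u => h u i) (q s i - conn τ (t s) (h s) i) s
  deriv_q : ∀ s ∈ I, ∀ i, HasDerivAt (fun u => q u i)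
    (curv τ (t s) (h s) (t s) i - conn τ (t s) (q s) i) s

theorem IsProperBiharmonic.isBiharmonicFrame {τ : ℝ} {I : Set ℝ} {γ : ℝ → Vec4}
    (hγ : IsProperBiharmonic τ I γ) (hτ : 0 < τ) (hI : IsOpen I) :
    IsBiharmonicFrame τ I (velocity τ γ) (covCoeff τ (velocity τ γ) (velocity τ γ))
      (covCoeff τ (velocity τ γ) (covCoeff τ (velocity τ γ) (velocity τ γ))) := by
  have ht := hγ.contDiffOn_velocity hI
  have hh := contDiffOn_covCoeff (τ := τ) hI ht ht
  have hq := contDiffOn_covCoeff (τ := τ) hI ht hh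
  refine ⟨fun s hs => hγ.velocity_norm hτ hI hs, fun s hs i => hasDerivAt_of_covCoeff hI ht hs i,
    fun s hs i => hasDerivAt_of_covCoeff hI hh hs i, fun s hs i => ?_⟩
  rw [← hγ.bitension_coeff hτ hI hs]
  exact hasDerivAt_of_covCoeff hI hq hs i

namespace IsBiharmonicFrame

variable {τ : ℝ} {I : Set ℝ} {t h q : ℝ → Fin 3 → ℝ}

/-- The inner product of two fields along the curve is differentiated by the connection. -/
theorem hasDerivAt_inner {x y : ℝ → Fin 3 → ℝ} {x' y' : Fin 3 → ℝ} {s : ℝ}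
    (hx : ∀ i, HasDerivAt (fun u => x u i) (x' i - conn τ (t s) (x s) i) s)
    (hy : ∀ i, HasDerivAt (fun u => y u i) (y' i - conn τ (t s) (y s) i) s) :
    HasDerivAt (fun u => x u 0 * y u 0 + x u 1 * y u 1 + x u 2 * y u 2)
      (x' 0 * y s 0 + x' 1 * y s 1 + x' 2 * y s 2
        + (x s 0 * y' 0 + x s 1 * y' 1 + x s 2 * y' 2)) s := by
  refine ((((hx 0).mul (hy 0)).add ((hx 1).mul (hy 1))).add ((hx 2).mul (hy 2))).congr_deriv ?_
  have := conn_metric τ (t s) (x s) (y s)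
  simp only [Fin.sum_univ_three] at this
  linear_combination -this

theorem inner_t_h (H : IsBiharmonicFrame τ I t h q) (hI : IsOpen I) {s : ℝ} (hs : s ∈ I) :
    t s 0 * h s 0 + t s 1 * h s 1 + t s 2 * h s 2 = 0 := by
  have := hasDerivAt_eq_zero hI hs (c := 1) (fun u hu => by linear_combination H.norm u hu)
    (hasDerivAt_inner (H.deriv_t s hs) (H.deriv_t s hs))
  linarith

theorem inner_t_q (H : IsBiharmonicFrame τ I t h q) (hI : IsOpen I) {s : ℝ} (hs : s ∈ I) :
    t s 0 * q s 0 + t s 1 * q s 1 + t s 2 * q s 2 = -(h s 0 ^ 2 + h s 1 ^ 2 + h s 2 ^ 2) := by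
  have := hasDerivAt_eq_zero hI hs (fun u hu => H.inner_t_h hI hu)
    (hasDerivAt_inner (H.deriv_t s hs) (H.deriv_h s hs))
  linarith

/-- Differentiating `⟨t,q⟩ + |h|² = 0` gives `3⟨h,q⟩ = 0`, since `⟨R(t,h)t, t⟩ = 0`. -/
theorem inner_h_q (H : IsBiharmonicFrame τ I t h q) (hτ : 0 < τ) (hI : IsOpen I) {s : ℝ}
    (hs : s ∈ I) : h s 0 * q s 0 + h s 1 * q s 1 + h s 2 * q s 2 = 0 := by
  have h1 := (hasDerivAt_inner (H.deriv_t s hs) (H.deriv_q s hs)).add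
    (hasDerivAt_inner (H.deriv_h s hs) (H.deriv_h s hs))
  have h2 := hasDerivAt_eq_zero hI hs (c := 0)
    (fun u hu => by simp only [Pi.add_apply]; linear_combination H.inner_t_q hI hu) h1
  simp only [curv_apply hτ, Matrix.cons_val] at h2
  linear_combination h2 / 3

/-- The geodesic curvature is constant. -/
theorem exists_norm_h (H : IsBiharmonicFrame τ I t h q) (hτ : 0 < τ) (hI : IsOpen I)
    (hc : IsConnected I) : ∃ K, ∀ s ∈ I, h s 0 ^ 2 + h s 1 ^ 2 + h s 2 ^ 2 = K := by
  obtain ⟨K, hK⟩ := exists_eq_of_hasDerivAt_zero hI hc (fun s hs => by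
    convert hasDerivAt_inner (H.deriv_h s hs) (H.deriv_h s hs) using 1
    linear_combination -2 * H.inner_h_q hτ hI hs)
  exact ⟨K, fun s hs => by rw [← hK s hs]; ring⟩

/-- The normal component of the biharmonic equation. -/
theorem norm_q (H : IsBiharmonicFrame τ I t h q) (hτ : 0 < τ) (hI : IsOpen I) {s : ℝ}
    (hs : s ∈ I) : q s 0 ^ 2 + q s 1 ^ 2 + q s 2 ^ 2
      = τ ^ 2 * (h s 0 ^ 2 + h s 1 ^ 2 + h s 2 ^ 2)
        - 4 * (1 + τ ^ 2) * (t s 1 * h s 2 - t s 2 * h s 1) ^ 2 := by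
  -- The derivative of `⟨h,q⟩ = 0` reads `|q|² = -⟨R(t,h)t, h⟩`, a sectional curvature times `K`.
  have h2 := hasDerivAt_eq_zero hI hs (fun u hu => H.inner_h_q hτ hI hu)
    (hasDerivAt_inner (H.deriv_h s hs) (H.deriv_q s hs))
  simp only [curv_apply hτ, Matrix.cons_val] at h2
  have e1 := H.norm s hs
  have e2 := H.inner_t_h hI hs
  linear_combination h2 + τ ^ 2 * (h s 0 ^ 2 + h s 1 ^ 2 + h s 2 ^ 2) * e1
    - τ ^ 2 * (t s 0 * h s 0 + t s 1 * h s 1 + t s 2 * h s 2) * e2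

/-- `⟨∇ₜ h, t × h⟩`, the geodesic torsion up to a constant factor. -/
def torsion (t h q : Fin 3 → ℝ) : ℝ :=
  (t 1 * h 2 - t 2 * h 1) * q 0 + (t 2 * h 0 - t 0 * h 2) * q 1 + (t 0 * h 1 - t 1 * h 0) * q 2

/-- The binormal component of the biharmonic equation. -/
theorem hasDerivAt_torsion (H : IsBiharmonicFrame τ I t h q) (hτ : 0 < τ) (hI : IsOpen I) {s : ℝ}
    (hs : s ∈ I) : HasDerivAt (fun u => torsion (t u) (h u) (q u))
      (-(4 * (1 + τ ^ 2)) * ((t s 1 * h s 2 - t s 2 * h s 1) * h s 0)) s := by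
  have dt := H.deriv_t s hs
  have dh := H.deriv_h s hs
  have dq := H.deriv_q s hs
  have e1 := H.norm s hs
  have e2 := H.inner_t_h hI hs
  refine ((((((dt 1).mul (dh 2)).sub ((dt 2).mul (dh 1))).mul (dq 0)).add
    ((((dt 2).mul (dh 0)).sub ((dt 0).mul (dh 2))).mul (dq 1))).add
    ((((dt 0).mul (dh 1)).sub ((dt 1).mul (dh 0))).mul (dq 2))).congr_deriv ?_
  simp only [curv_apply hτ, conn, Matrix.cons_val, Pi.mul_apply, Pi.sub_apply]
  linear_combination (-(4 * (1 + τ ^ 2)) * ((t s 1 * h s 2 - t s 2 * h s 1) * h s 0)) * e1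
    + 4 * (1 + τ ^ 2) * ((t s 1 * h s 2 - t s 2 * h s 1) * t s 0) * e2

end IsBiharmonicFrame

/-! ### Horizontality of the tension field and constant rotation -/

namespace IsBiharmonicFrame

variable {τ : ℝ} {I : Set ℝ} {t h q : ℝ → Fin 3 → ℝ}

/-- The component along `E₁` of the binormal direction `t × h`. -/
theorem hasDerivAt_binormal (H : IsBiharmonicFrame τ I t h q) (hI : IsOpen I)
    {s : ℝ} (hs : s ∈ I) : HasDerivAt (fun u => t u 1 * h u 2 - t u 2 * h u 1)
      (t s 1 * q s 2 - t s 2 * q s 1 + τ * h s 0) s := by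
  have dt := H.deriv_t s hs
  have dh := H.deriv_h s hs
  have e1 := H.norm s hs
  have e2 := H.inner_t_h hI hs
  refine (((dt 1).mul (dh 2)).sub ((dt 2).mul (dh 1))).congr_deriv ?_
  simp only [conn, Matrix.cons_val]
  linear_combination τ * h s 0 * e1 - τ * t s 0 * e2

/-- `torsion` is `det(t,h,q)`, so its square is the Gram determinant, all of whose entries are known
except `|q|²`. -/
theorem torsion_sq {t h q : Fin 3 → ℝ} {K : ℝ} (hK : h 0 ^ 2 + h 1 ^ 2 + h 2 ^ 2 = K)
    (e1 : t 0 ^ 2 + t 1 ^ 2 + t 2 ^ 2 = 1) (e2 : t 0 * h 0 + t 1 * h 1 + t 2 * h 2 = 0)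
    (e3 : t 0 * q 0 + t 1 * q 1 + t 2 * q 2 = -K) (e4 : h 0 * q 0 + h 1 * q 1 + h 2 * q 2 = 0) :
    torsion t h q ^ 2 + K ^ 3 = K * (q 0 ^ 2 + q 1 ^ 2 + q 2 ^ 2) := by
  have gram : torsion t h q ^ 2
      = (t 0 ^ 2 + t 1 ^ 2 + t 2 ^ 2) * (h 0 ^ 2 + h 1 ^ 2 + h 2 ^ 2) * (q 0 ^ 2 + q 1 ^ 2 + q 2 ^ 2)
        + 2 * (t 0 * h 0 + t 1 * h 1 + t 2 * h 2) * (t 0 * q 0 + t 1 * q 1 + t 2 * q 2)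
          * (h 0 * q 0 + h 1 * q 1 + h 2 * q 2)
        - (t 0 ^ 2 + t 1 ^ 2 + t 2 ^ 2) * (h 0 * q 0 + h 1 * q 1 + h 2 * q 2) ^ 2
        - (h 0 ^ 2 + h 1 ^ 2 + h 2 ^ 2) * (t 0 * q 0 + t 1 * q 1 + t 2 * q 2) ^ 2
        - (q 0 ^ 2 + q 1 ^ 2 + q 2 ^ 2) * (t 0 * h 0 + t 1 * h 1 + t 2 * h 2) ^ 2 := by
    simp only [torsion]; ring
  rw [gram, hK, e1, e2, e3, e4]; ring

/-- `⟨t × q, E₁⟩` in terms of the torsion. -/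
theorem cross_t_q {t h q : Fin 3 → ℝ} {K : ℝ} (hK : h 0 ^ 2 + h 1 ^ 2 + h 2 ^ 2 = K)
    (e2 : t 0 * h 0 + t 1 * h 1 + t 2 * h 2 = 0)
    (e4 : h 0 * q 0 + h 1 * q 1 + h 2 * q 2 = 0) :
    K * (t 1 * q 2 - t 2 * q 1) = -(torsion t h q * h 0) := by
  -- `h × (t × q) = t⟨h,q⟩ - q⟨h,t⟩ = 0`, so `t × q` is parallel to `h`, and `⟨t × q, h⟩ =
  -- -det(t,h,q)` fixes the factor.
  have key : (h 0 ^ 2 + h 1 ^ 2 + h 2 ^ 2) * (t 1 * q 2 - t 2 * q 1) + torsion t h q * h 0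
      = (h 0 * q 0 + h 1 * q 1 + h 2 * q 2) * (t 1 * h 2 - t 2 * h 1)
        + (t 0 * h 0 + t 1 * h 1 + t 2 * h 2) * (h 1 * q 2 - h 2 * q 1) := by
    simp only [torsion]; ring
  rw [hK, e2, e4] at key
  linarith

/-- The tension field of a proper biharmonic curve is horizontal. -/
theorem h_zero (H : IsBiharmonicFrame τ I t h q) (hτ : 0 < τ) (hI : IsOpen I) {K : ℝ}
    (hK0 : K ≠ 0) (hK : ∀ s ∈ I, h s 0 ^ 2 + h s 1 ^ 2 + h s 2 ^ 2 = K) {s : ℝ} (hs : s ∈ I) :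
    h s 0 = 0 := by
  set w : ℝ → ℝ := fun u => t u 1 * h u 2 - t u 2 * h u 1 with hw
  set S : ℝ → ℝ := fun u => torsion (t u) (h u) (q u) with hS
  have dw : ∀ u ∈ I, HasDerivAt w (t u 1 * q u 2 - t u 2 * q u 1 + τ * h u 0) u :=
    fun u hu => H.hasDerivAt_binormal hI hu
  have dw' : ∀ u ∈ I, K * (t u 1 * q u 2 - t u 2 * q u 1 + τ * h u 0)
      = (τ * K - S u) * h u 0 := by
    intro u hu
    have := cross_t_q (hK u hu) (H.inner_t_h hI hu) (H.inner_h_q hτ hI hu)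
    simp only [hS]; linear_combination this
  have dS : ∀ u ∈ I, HasDerivAt S (-(4 * (1 + τ ^ 2)) * (w u * h u 0)) u :=
    fun u hu => H.hasDerivAt_torsion hτ hI hu
  have rel : ∀ u ∈ I, S u ^ 2 + 4 * K * (1 + τ ^ 2) * w u ^ 2 = τ ^ 2 * K ^ 2 - K ^ 3 := by
    intro u hu
    have h1 := torsion_sq (hK u hu) (H.norm u hu) (H.inner_t_h hI hu)
      (by rw [H.inner_t_q hI hu, hK u hu]) (H.inner_h_q hτ hI hu)
    rw [H.norm_q hτ hI hu, hK u hu] at h1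
    simp only [hS, hw]; linear_combination h1
  have pos : (1 + τ ^ 2) ≠ 0 := by positivity
  have ch : ∀ u ∈ I, ContinuousAt (fun v => h v 0) u := fun u hu => (H.deriv_h u hu 0).continuousAt
  -- Differentiating `rel` gives `w h₀ (τK - 2S) = 0` up to a positive factor.
  have alt : ∀ u ∈ I, w u * h u 0 ≠ 0 → 2 * S u = τ * K := by
    intro u hu hne
    have h1 := hasDerivAt_eq_zero hI hu rel (((dS u hu).pow 2).add
      (((dw u hu).pow 2).const_mul (4 * K * (1 + τ ^ 2))))
    have h2 := dw' u hu
    have h3 : (8 * (1 + τ ^ 2) * (w u * h u 0)) * (τ * K - 2 * S u) = 0 := by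
      norm_num at h1
      linear_combination h1 - 8 * (1 + τ ^ 2) * w u * h2
    rcases mul_eq_zero.1 h3 with h4 | h4
    · exact absurd h4 (mul_ne_zero (by positivity) hne)
    · linarith
  -- If `w h₀ ≠ 0` at a point, then `S = τK/2` nearby, so `S' = 0`; but `S'` is a nonzero multiple
  -- of `w h₀`.
  have prod : ∀ u ∈ I, w u * h u 0 = 0 := by
    intro u hu
    by_contra hne
    have ev : ∀ᶠ v in nhds u, (fun _ => τ * K / 2) v = S v := by
      filter_upwards [hI.mem_nhds hu, ((dw u hu).continuousAt.mul (ch u hu)).eventually_ne hne]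
        with v hv hv'
      linarith [alt v hv hv']
    have := ((dS u hu).congr_of_eventuallyEq ev).unique (hasDerivAt_const u (τ * K / 2))
    rcases mul_eq_zero.1 this with h4 | h4
    · exact pos (by linarith)
    · exact hne h4
  -- Where `h₀ ≠ 0`, `w` vanishes on a neighbourhood, so `w' = 0` gives `S = τK`; then `rel` reduces
  -- to `K³ = 0`.
  by_contra hne
  have ev : ∀ᶠ v in nhds s, (fun _ => (0 : ℝ)) v = w v := by
    filter_upwards [hI.mem_nhds hs, (ch s hs).eventually_ne hne] with v hv hv'
    exact ((mul_eq_zero.1 (prod v hv)).resolve_right hv').symm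
  have h0 := ((dw s hs).congr_of_eventuallyEq ev).unique (hasDerivAt_const s (0 : ℝ))
  have h1 := dw' s hs
  rw [h0, mul_zero] at h1
  have h2 : S s = τ * K := by
    rcases mul_eq_zero.1 h1.symm with h3 | h3
    · linarith
    · exact absurd h3 hne
  have h3 := rel s hs
  have h4 : w s = 0 := ev.self_of_nhds.symm
  rw [h2, h4] at h3
  exact hK0 (pow_eq_zero_iff (three_ne_zero) |>.1 (by linarith))

/-- The velocity of a proper biharmonic curve makes a constant angle with `E₁` and its
horizontal part rotates with constant speed. -/
theorem exists_rotation (H : IsBiharmonicFrame τ I t h q) (hτ : 0 < τ) (hI : IsOpen I)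
    (hc : IsConnected I) (hne : ∃ s ∈ I, h s ≠ 0) :
    ∃ c b, c ^ 2 < 1 ∧ ∀ s ∈ I, t s 0 = c ∧ HasDerivAt (fun u => t u 1) (b * t s 2) s ∧
      HasDerivAt (fun u => t u 2) (-(b * t s 1)) s := by
  obtain ⟨K, hK⟩ := H.exists_norm_h hτ hI hc
  obtain ⟨s₀, hs₀, hn⟩ := hne
  have hK0 : K ≠ 0 := by
    rintro rfl
    have := hK s₀ hs₀
    apply hn
    have h0 : h s₀ 0 = 0 := by nlinarith [sq_nonneg (h s₀ 0), sq_nonneg (h s₀ 1), sq_nonneg (h s₀ 2)]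
    have h1 : h s₀ 1 = 0 := by nlinarith [sq_nonneg (h s₀ 0), sq_nonneg (h s₀ 1), sq_nonneg (h s₀ 2)]
    have h2 : h s₀ 2 = 0 := by nlinarith [sq_nonneg (h s₀ 0), sq_nonneg (h s₀ 1), sq_nonneg (h s₀ 2)]
    ext i; fin_cases i <;> simp [h0, h1, h2]
  have hz : ∀ s ∈ I, h s 0 = 0 := fun s hs => H.h_zero hτ hI hK0 hK hs
  obtain ⟨c, hct⟩ := exists_eq_of_hasDerivAt_zero hI hc (f := fun s => t s 0) (fun s hs => by
    refine (H.deriv_t s hs 0).congr_deriv ?_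
    rw [hz s hs]; simp only [conn, Matrix.cons_val]; ring)
  have hort : ∀ s ∈ I, t s 1 * h s 1 + t s 2 * h s 2 = 0 := by
    intro s hs
    have := H.inner_t_h hI hs
    rw [hz s hs] at this; linarith
  have hcirc : ∀ s ∈ I, t s 1 ^ 2 + t s 2 ^ 2 = 1 - c ^ 2 := by
    intro s hs
    have := H.norm s hs
    have h0 : t s 0 = c := hct s hs
    rw [h0] at this; linarith
  have hsq : ∀ s ∈ I, (t s 1 * h s 2 - t s 2 * h s 1) ^ 2 = K * (1 - c ^ 2) := by
    intro s hs
    have h1 := hK s hs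
    rw [hz s hs] at h1
    rw [← hcirc s hs]
    linear_combination (t s 1 ^ 2 + t s 2 ^ 2) * h1
      - (t s 1 * h s 1 + t s 2 * h s 2) * hort s hs
  -- Otherwise `t = ±E₁` throughout, and then the tension field vanishes.
  have hc1 : c ^ 2 < 1 := by
    rcases lt_or_ge (c ^ 2) 1 with h1 | h1
    · exact h1
    exfalso
    have hall : ∀ s ∈ I, t s 1 = 0 ∧ t s 2 = 0 := by
      intro s hs
      have := hcirc s hs
      constructor <;> nlinarith [sq_nonneg (t s 1), sq_nonneg (t s 2)]
    have h1 := hasDerivAt_eq_zero hI hs₀ (fun u hu => (hall u hu).1) (H.deriv_t s₀ hs₀ 1)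
    have h2 := hasDerivAt_eq_zero hI hs₀ (fun u hu => (hall u hu).2) (H.deriv_t s₀ hs₀ 2)
    simp only [conn, Matrix.cons_val, (hall s₀ hs₀).1, (hall s₀ hs₀).2] at h1 h2
    apply hn
    ext i; fin_cases i
    · exact hz s₀ hs₀
    · simpa using h1
    · simpa using h2
  have hd : (1 - c ^ 2) ≠ 0 := by linarith
  -- `w²` is a nonzero constant, so `w w' = 0` forces `w' = 0`.
  obtain ⟨f, hf⟩ := exists_eq_of_hasDerivAt_zero hI hc
    (f := fun u => t u 1 * h u 2 - t u 2 * h u 1) (fun s hs => by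
    have d := H.hasDerivAt_binormal hI hs
    have h1 := hasDerivAt_eq_zero hI hs hsq (d.pow 2)
    refine d.congr_deriv ?_
    have h2 : (t s 1 * h s 2 - t s 2 * h s 1) ≠ 0 := fun h0 => by
      have := hsq s hs
      rw [h0] at this
      exact mul_ne_zero hK0 hd (by linarith)
    norm_num at h1
    exact h1.resolve_left h2)
  have hf : ∀ s ∈ I, t s 1 * h s 2 - t s 2 * h s 1 = f := hf
  -- With `h` horizontal and orthogonal to `t`, `h = f/(1-c²) · (0, -t₂, t₁)`; the second term of
  -- the speed comes from the connection.
  refine ⟨c, -(f / (1 - c ^ 2)) - (τ⁻¹ * (2 + τ ^ 2) + τ) * c, hc1, fun s hs => ⟨hct s hs, ?_, ?_⟩⟩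
  · refine (H.deriv_t s hs 1).congr_deriv ?_
    have h0 : t s 0 = c := hct s hs
    have : h s 1 = -(f / (1 - c ^ 2)) * t s 2 := by
      field_simp
      linear_combination -h s 1 * hcirc s hs + t s 1 * hort s hs - t s 2 * hf s hs
    simp only [conn, Matrix.cons_val, this, h0]
    ring
  · refine (H.deriv_t s hs 2).congr_deriv ?_
    have h0 : t s 0 = c := hct s hs
    have : h s 2 = (f / (1 - c ^ 2)) * t s 1 := by
      field_simp
      linear_combination -h s 2 * hcirc s hs + t s 2 * hort s hs + t s 1 * hf s hs
    simp only [conn, Matrix.cons_val, this, h0]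
    ring

end IsBiharmonicFrame

/-! ### Angle, phase and the relation between them -/

/-- A rotating vector of constant length has a linear phase. -/
theorem exists_phase {I : Set ℝ} (hI : IsOpen I) (hc : IsConnected I) {x y : ℝ → ℝ} {b r : ℝ}
    (hr : 0 < r) (hxy : ∀ s ∈ I, x s ^ 2 + y s ^ 2 = r ^ 2)
    (hx : ∀ s ∈ I, HasDerivAt x (b * y s) s) (hy : ∀ s ∈ I, HasDerivAt y (-(b * x s)) s) :
    ∃ β₀, ∀ s ∈ I, x s = r * Real.sin (β₀ + b * s) ∧ y s = r * Real.cos (β₀ + b * s) := by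
  have dl : ∀ s, HasDerivAt (fun u : ℝ => b * u) b s := fun s => by
    simpa using (hasDerivAt_id s).const_mul b
  -- Rotating `(x, y)` back by the angle `bs` leaves the constants `p = r sin β₀` and `k = r cos
  -- β₀`, so `β₀` is an argument of `k + ip`.
  obtain ⟨p, hp⟩ := exists_eq_of_hasDerivAt_zero hI hc
    (f := fun s => x s * Real.cos (b * s) - y s * Real.sin (b * s)) (fun s hs =>
    (((hx s hs).mul (dl s).cos).sub ((hy s hs).mul (dl s).sin)).congr_deriv (by ring))
  obtain ⟨k, hk⟩ := exists_eq_of_hasDerivAt_zero hI hc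
    (f := fun s => x s * Real.sin (b * s) + y s * Real.cos (b * s)) (fun s hs =>
    (((hx s hs).mul (dl s).sin).add ((hy s hs).mul (dl s).cos)).congr_deriv (by ring))
  have hp : ∀ s ∈ I, x s * Real.cos (b * s) - y s * Real.sin (b * s) = p := hp
  have hk : ∀ s ∈ I, x s * Real.sin (b * s) + y s * Real.cos (b * s) = k := hk
  have hpk : k ^ 2 + p ^ 2 = r ^ 2 := by
    obtain ⟨s, hs⟩ := hc.nonempty
    rw [← hxy s hs, ← hp s hs, ← hk s hs]
    linear_combination (x s ^ 2 + y s ^ 2) * Real.sin_sq_add_cos_sq (b * s)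
  have hn : ‖(⟨k, p⟩ : ℂ)‖ = r := by
    rw [Complex.norm_def, Complex.normSq_apply, ← Real.sqrt_sq hr.le, ← hpk]
    congr 1; ring
  refine ⟨Complex.arg ⟨k, p⟩, fun s hs => ?_⟩
  have h1 : r * Real.cos (Complex.arg ⟨k, p⟩) = k := by
    rw [← hn]; exact Complex.norm_mul_cos_arg _
  have h2 : r * Real.sin (Complex.arg ⟨k, p⟩) = p := by
    rw [← hn]; exact Complex.norm_mul_sin_arg _
  have h3 := Real.sin_sq_add_cos_sq (b * s)
  rw [Real.sin_add, Real.cos_add]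
  constructor
  · linear_combination -x s * h3 - Real.cos (b * s) * h2 - Real.sin (b * s) * h1
      + Real.cos (b * s) * hp s hs + Real.sin (b * s) * hk s hs
  · linear_combination -y s * h3 - Real.cos (b * s) * h1 + Real.sin (b * s) * h2
      - Real.sin (b * s) * hp s hs + Real.cos (b * s) * hk s hs

theorem IsProperBiharmonic.exists_angleData {τ : ℝ} {I : Set ℝ} {γ : ℝ → Vec4}
    (hγ : IsProperBiharmonic τ I γ) (hτ : 0 < τ) (hI : IsOpen I) (hc : IsConnected I)
    (horient : ∀ s ∈ I, 0 ≤ metric τ (γ s) (deriv γ s) (frame τ 0 (γ s))) :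
    ∃ (ϑ b : ℝ) (β : ℝ → ℝ), IsAngleData τ I γ ϑ b β := by
  have H := hγ.isBiharmonicFrame hτ hI
  obtain ⟨c, b, hc1, hrot⟩ := H.exists_rotation hτ hI hc hγ.exists_tension_ne
  have hc0 : 0 ≤ c := by
    obtain ⟨s, hs⟩ := hc.nonempty
    rw [← (hrot s hs).1]
    exact horient s hs
  have hr : 0 < √(1 - c ^ 2) := Real.sqrt_pos.2 (by linarith)
  obtain ⟨β₀, hβ⟩ := exists_phase hI hc hr (fun s hs => by
      have := H.norm s hs
      rw [(hrot s hs).1] at this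
      rw [Real.sq_sqrt (by linarith)]; linarith)
    (fun s hs => (hrot s hs).2.1) (fun s hs => (hrot s hs).2.2)
  have hcos : Real.cos (Real.arccos c) = c := Real.cos_arccos (by linarith) (by nlinarith)
  refine ⟨Real.arccos c, b, fun s => β₀ + b * s,
    ⟨Real.arccos_pos.2 (by nlinarith), Real.arccos_le_pi_div_two.2 hc0⟩, by fun_prop, ?_, ?_⟩
  · intro s hs
    rw [hcos, Real.sin_arccos, ← (hβ s hs).1, ← (hβ s hs).2, ← (hrot s hs).1,
      ← hγ.field_velocity hτ hI hs]
    simp [field, Fin.sum_univ_three]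
  · intro s _
    simp

/-- The biharmonic equation as a relation between the angle and the rotation speed. -/
theorem IsBiharmonicFrame.rotation_relation {τ : ℝ} {I : Set ℝ} {t h q : ℝ → Fin 3 → ℝ}
    (H : IsBiharmonicFrame τ I t h q) (hτ : 0 < τ) (hI : IsOpen I) (hne : ∃ s ∈ I, h s ≠ 0)
    {c b : ℝ} (h0 : ∀ s ∈ I, t s 0 = c) (h1 : ∀ s ∈ I, HasDerivAt (fun u => t u 1) (b * t s 2) s)
    (h2 : ∀ s ∈ I, HasDerivAt (fun u => t u 2) (-(b * t s 1)) s) :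
    (b + τ⁻¹ * (2 + τ ^ 2) * c) ^ 2 = (4 + 5 * τ ^ 2) * c ^ 2 - 4 * (1 + τ ^ 2) := by
  set m := b + τ⁻¹ * (2 + τ ^ 2) * c with hm
  -- Chosen so that `h = w (0, t₂, -t₁)`; the horizontal part of `q` is then `-wm (t₁, t₂)`.
  set w := m + τ * c with hw
  have eh0 : ∀ s ∈ I, h s 0 = 0 := by
    intro s hs
    have := hasDerivAt_eq_zero hI hs h0 (H.deriv_t s hs 0)
    simp only [conn, Matrix.cons_val] at this
    linarith
  have eh1 : ∀ s ∈ I, h s 1 = w * t s 2 := by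
    intro s hs
    have := (H.deriv_t s hs 1).unique (h1 s hs)
    simp only [conn, Matrix.cons_val, h0 s hs] at this
    rw [hw, hm]; linear_combination this
  have eh2 : ∀ s ∈ I, h s 2 = -(w * t s 1) := by
    intro s hs
    have := (H.deriv_t s hs 2).unique (h2 s hs)
    simp only [conn, Matrix.cons_val, h0 s hs] at this
    rw [hw, hm]; linear_combination this
  have eq0 : ∀ s ∈ I, q s 0 = -(τ * w * (1 - c ^ 2)) := by
    intro s hs
    have h3 := hasDerivAt_eq_zero hI hs eh0 (H.deriv_h s hs 0)
    have h4 := H.norm s hs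
    simp only [conn, Matrix.cons_val, h0 s hs, eh1 s hs, eh2 s hs] at h3 h4
    linear_combination h3 - τ * w * h4
  have eq1 : ∀ s ∈ I, q s 1 = -(w * m * t s 1) := by
    intro s hs
    have h3 := ((h2 s hs).const_mul w).congr_of_eventuallyEq (f₁ := fun u => h u 1)
      (by filter_upwards [hI.mem_nhds hs] with u hu using eh1 u hu)
    have h4 := (H.deriv_h s hs 1).unique h3
    simp only [conn, Matrix.cons_val, h0 s hs, eh0 s hs, eh2 s hs] at h4
    rw [hm]; linear_combination h4
  have eq2 : ∀ s ∈ I, q s 2 = -(w * m * t s 2) := by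
    intro s hs
    have h3 := ((h1 s hs).const_mul w).neg.congr_of_eventuallyEq (f₁ := fun u => h u 2)
      (by filter_upwards [hI.mem_nhds hs] with u hu using eh2 u hu)
    have h4 := (H.deriv_h s hs 2).unique h3
    simp only [conn, Matrix.cons_val, h0 s hs, eh0 s hs, eh1 s hs] at h4
    rw [hm]; linear_combination h4
  obtain ⟨s, hs, hn⟩ := hne
  have hN := H.norm s hs
  have h3 := H.norm_q hτ hI hs
  simp only [h0 s hs, eh0 s hs, eh1 s hs, eh2 s hs, eq0 s hs, eq1 s hs, eq2 s hs] at h3 hN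
  have hw0 : w ≠ 0 := by
    rintro hz
    apply hn
    ext i; fin_cases i <;> simp [eh0 s hs, eh1 s hs, eh2 s hs, hz]
  have h4 : t s 1 ^ 2 + t s 2 ^ 2 = 1 - c ^ 2 := by linarith
  have hd : 1 - c ^ 2 ≠ 0 := by
    intro hd
    have e1 : t s 1 = 0 := pow_eq_zero_iff two_ne_zero |>.1 (by
      linarith only [h4, hd, sq_nonneg (t s 1), sq_nonneg (t s 2)])
    have e2 : t s 2 = 0 := pow_eq_zero_iff two_ne_zero |>.1 (by
      linarith only [h4, hd, sq_nonneg (t s 1), sq_nonneg (t s 2)])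
    apply hn
    ext i; fin_cases i <;> simp [eh0 s hs, eh1 s hs, eh2 s hs, e1, e2]
  -- This is `norm_q` after substitution; the prefactor is `|h|²`, nonzero because the curve is not
  -- a geodesic.
  have h5 : w ^ 2 * (1 - c ^ 2) * (m ^ 2 - ((4 + 5 * τ ^ 2) * c ^ 2 - 4 * (1 + τ ^ 2))) = 0 := by
    linear_combination h3 - (w ^ 2 * m ^ 2 - τ ^ 2 * w ^ 2
      + 4 * (1 + τ ^ 2) * w ^ 2 * (t s 1 ^ 2 + t s 2 ^ 2 + (1 - c ^ 2))) * h4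
  have h6 := (mul_eq_zero.1 h5).resolve_left (mul_ne_zero (pow_ne_zero 2 hw0) hd)
  linarith

/-- `a` in terms of `B̃`. -/
theorem aConst_eq (τ ϑ b : ℝ) : aConst τ ϑ b = -bTilde τ ϑ - τ⁻¹ * Real.cos ϑ * b := by
  rw [aConst, bTilde, Real.cos_two_mul]; ring

/-! ### Inequalities for the parameters and the two frequencies -/

section Parameters

variable {τ c b : ℝ}

/-- The right side of `hrel` is `(τc)² - 4(1+τ²)(1-c²)`, so `b + τ⁻¹(2+τ²)c < τc`. This bound on `b`
is the source of every sign in the theorem: `b < 0`, `a > 0`, `C₁₁ < 0`. -/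
theorem rotation_lt (hτ : 0 < τ) (hc0 : 0 ≤ c) (hc1 : c < 1)
    (hrel : (b + τ⁻¹ * (2 + τ ^ 2) * c) ^ 2 = (4 + 5 * τ ^ 2) * c ^ 2 - 4 * (1 + τ ^ 2)) :
    0 < c ∧ b < -(2 * τ⁻¹ * c) := by
  have hc : 0 < c := by
    rcases hc0.eq_or_lt with h | h
    · rw [← h] at hrel; nlinarith [sq_nonneg (b + τ⁻¹ * (2 + τ ^ 2) * 0), sq_nonneg τ]
    · exact h
  refine ⟨hc, ?_⟩
  have h1 : (b + τ⁻¹ * (2 + τ ^ 2) * c) ^ 2 < (τ * c) ^ 2 := by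
    rw [hrel]
    nlinarith [mul_pos (show 0 < 1 + τ ^ 2 by positivity) (show 0 < 1 - c ^ 2 by nlinarith)]
  have h2 := (abs_lt_of_sq_lt_sq' h1 (by positivity)).2
  have h3 : τ⁻¹ * (2 + τ ^ 2) * c = 2 * τ⁻¹ * c + τ * c := by field_simp
  linarith

/-- With `R = b + τ⁻¹(2+τ²)c`, `hΔ` becomes `τcR < (4+3τ²)c² - 4 - 2τ²`. Since `R ≥ 0` it may be
squared, and after eliminating `R²` a factor `1 - c²` splits off. For negative `R` squaring is not
available, so case (ii) has no upper bound. -/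
theorem cos_sq_lt (hτ : 0 < τ) (hc0 : 0 < c) (hc1 : c < 1)
    (hrel : (b + τ⁻¹ * (2 + τ ^ 2) * c) ^ 2 = (4 + 5 * τ ^ 2) * c ^ 2 - 4 * (1 + τ ^ 2))
    (hb : -(τ⁻¹ * (2 + τ ^ 2) * c) ≤ b)
    (hΔ : 0 < b ^ 2 - 4 * (1 - (1 + (τ ^ 2)⁻¹) * c ^ 2 - τ⁻¹ * c * b)) :
    c ^ 2 < (2 + τ ^ 2) ^ 2 / (4 + 5 * τ ^ 2 + τ ^ 4) := by
  set R := b + τ⁻¹ * (2 + τ ^ 2) * c with hR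
  have hb' : b = R - τ⁻¹ * (2 + τ ^ 2) * c := by rw [hR]; ring
  have hR0 : 0 ≤ R := by linarith
  have h1 : b ^ 2 - 4 * (1 - (1 + (τ ^ 2)⁻¹) * c ^ 2 - τ⁻¹ * c * b)
      = (8 + 6 * τ ^ 2) * c ^ 2 - 8 - 4 * τ ^ 2 - 2 * τ * c * R := by
    have : b ^ 2 - 4 * (1 - (1 + (τ ^ 2)⁻¹) * c ^ 2 - τ⁻¹ * c * b)
      = R ^ 2 - 4 + 4 * c ^ 2 + τ ^ 2 * c ^ 2 - 2 * τ * c * R := by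
      rw [hb']; field_simp; ring
    rw [this, hrel]; ring
  rw [h1] at hΔ
  have hcR : 0 ≤ τ * c * R := by positivity
  have h2 : (τ * c * R) ^ 2 < ((4 + 3 * τ ^ 2) * c ^ 2 - 4 - 2 * τ ^ 2) ^ 2 :=
    pow_lt_pow_left₀ (by linarith) hcR two_ne_zero
  rw [mul_pow, hrel] at h2
  have h3 : 0 < (1 - c ^ 2) * ((2 + τ ^ 2) ^ 2 - c ^ 2 * (4 + 5 * τ ^ 2 + τ ^ 4)) := by
    linarith
  rw [lt_div_iff₀ (by positivity)]
  have := (mul_pos_iff_of_pos_left (show 0 < 1 - c ^ 2 by nlinarith)).1 h3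
  linarith

end Parameters

section Frequencies

variable {a b : ℝ}

/-- For `b < 0` the nested radicand is a perfect square, so `α₁` and `α₂` are the roots of `x² + bx
+ a`. -/
theorem alpha1_eq (hb : b < 0) (hΔ : 4 * a < b ^ 2) :
    alpha1 a b = (-b + √(b ^ 2 - 4 * a)) / 2 := by
  have h1 : √(b ^ 2 * (b ^ 2 - 4 * a)) = -b * √(b ^ 2 - 4 * a) := by
    rw [Real.sqrt_mul (sq_nonneg b), Real.sqrt_sq_eq_abs, abs_of_neg hb]
  have h2 := Real.sq_sqrt (show 0 ≤ b ^ 2 - 4 * a by linarith)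
  rw [alpha1, h1, ← Real.sqrt_sq (show 0 ≤ (-b + √(b ^ 2 - 4 * a)) / 2 by
    have := Real.sqrt_nonneg (b ^ 2 - 4 * a); linarith)]
  congr 1
  linear_combination -h2 / 4

theorem alpha2_eq (hb : b < 0) (ha : 0 < a) (hΔ : 4 * a < b ^ 2) :
    alpha2 a b = (-b - √(b ^ 2 - 4 * a)) / 2 := by
  have h1 : √(b ^ 2 * (b ^ 2 - 4 * a)) = -b * √(b ^ 2 - 4 * a) := by
    rw [Real.sqrt_mul (sq_nonneg b), Real.sqrt_sq_eq_abs, abs_of_neg hb]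
  have h2 := Real.sq_sqrt (show 0 ≤ b ^ 2 - 4 * a by linarith)
  have h3 : √(b ^ 2 - 4 * a) ≤ -b := Real.sqrt_le_iff.2 ⟨by linarith, by nlinarith⟩
  rw [alpha2, h1, ← Real.sqrt_sq (show 0 ≤ (-b - √(b ^ 2 - 4 * a)) / 2 by linarith)]
  congr 1
  linear_combination -h2 / 4

theorem alpha_facts (hb : b < 0) (ha : 0 < a) (hΔ : 4 * a < b ^ 2) :
    0 < alpha2 a b ∧ alpha2 a b < alpha1 a b ∧ alpha1 a b + alpha2 a b = -b ∧
      alpha1 a b * alpha2 a b = a := by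
  rw [alpha1_eq hb hΔ, alpha2_eq hb ha hΔ]
  have h2 := Real.sq_sqrt (show 0 ≤ b ^ 2 - 4 * a by linarith)
  have h0 : 0 < √(b ^ 2 - 4 * a) := Real.sqrt_pos.2 (by linarith)
  have h3 : √(b ^ 2 - 4 * a) < -b := (Real.sqrt_lt' (by linarith)).2 (by nlinarith)
  refine ⟨by linarith, by linarith, by ring, by linear_combination -h2 / 4⟩

end Frequencies

/-! ### The linear equation in `ℂ²` and antilinear isometries -/

theorem inner_field_self (τ : ℝ) (x : Fin 3 → ℝ) (p : Vec4) :
    inner22 (field τ x p) (field τ x p)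
      = ((τ⁻¹ * x 0) ^ 2 - x 1 ^ 2 - x 2 ^ 2) * inner22 p p := by
  simp only [field_apply, inner22, Matrix.cons_val]; ring

theorem inner_X1_field (τ : ℝ) (x : Fin 3 → ℝ) (p : Vec4) :
    inner22 p (X1 (field τ x p)) = τ⁻¹ * x 0 * inner22 p p := by
  simp only [field_apply, inner22, X1, Matrix.cons_val]; ring

theorem hasDerivAt_X1 {P : ℝ → Vec4} {P' : Vec4} {s : ℝ} (h : HasDerivAt P P' s) :
    HasDerivAt (fun u => X1 (P u)) (X1 P') s := by
  have h := hasDerivAt_pi.1 h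
  refine hasDerivAt_pi.2 fun k => ?_
  fin_cases k
  · exact (h 1).neg
  · exact h 0
  · exact (h 3).neg
  · exact h 2

theorem X1_X1 (p : Vec4) : X1 (X1 p) = -p := by
  ext k; fin_cases k <;> simp [X1]

theorem X1_smul (c : ℝ) (p : Vec4) : X1 (c • p) = c • X1 p := by
  ext k; fin_cases k <;> simp [X1]

theorem X1_add (p q : Vec4) : X1 (p + q) = X1 p + X1 q := by
  ext k; fin_cases k <;> simp [X1] <;> ring

theorem X1_sub (p q : Vec4) : X1 (p - q) = X1 p - X1 q := by
  ext k; fin_cases k <;> simp [X1] <;> ring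

/-- Solutions of `P' = -α i P` are `e^{-iαs} p`. -/
theorem exists_rotating {I : Set ℝ} (hI : IsOpen I) (hc : IsConnected I) {P : ℝ → Vec4} {α : ℝ}
    (hP : ∀ s ∈ I, HasDerivAt P (-(α • X1 (P s))) s) :
    ∃ p, ∀ s ∈ I, Real.cos (α * s) • P s + Real.sin (α * s) • X1 (P s) = p := by
  have dl : ∀ s, HasDerivAt (fun u : ℝ => α * u) α s := fun s => by
    simpa using (hasDerivAt_id s).const_mul α
  have key : ∀ s ∈ I, HasDerivAt
      (fun u => Real.cos (α * u) • P u + Real.sin (α * u) • X1 (P u)) 0 s := by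
    intro s hs
    refine (((dl s).cos.smul (hP s hs)).add
      ((dl s).sin.smul (hasDerivAt_X1 (hP s hs)))).congr_deriv ?_
    have : X1 (-(α • X1 (P s))) = α • P s := by
      rw [← neg_smul, X1_smul, X1_X1, smul_neg, neg_smul, neg_neg]
    rw [this]
    module
  exact hI.exists_is_const_of_deriv_eq_zero hc.isPreconnected
    (fun s hs => (key s hs).differentiableAt.differentiableWithinAt)
    (fun s hs => (key s hs).deriv)

/-- The matrix of the antilinear map of `ℂ²` sending the standard basis to `p`, `q`. -/
def antilinearMatrix (p q : Vec4) : Matrix (Fin 4) (Fin 4) ℝ :=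
  Matrix.of fun i => ![p i, -X1 p i, q i, -X1 q i]

theorem antilinearMatrix_mulVec (p q x : Vec4) : (antilinearMatrix p q).mulVec x
    = x 0 • p - x 1 • X1 p + x 2 • q - x 3 • X1 q := by
  ext i
  simp [antilinearMatrix, Matrix.mulVec, dotProduct, Fin.sum_univ_four]; ring

theorem antilinearMatrix_mul_J1 (p q : Vec4) :
    antilinearMatrix p q * J1 = -(J1 * antilinearMatrix p q) := by
  ext i j
  fin_cases i <;> fin_cases j <;>
    simp [antilinearMatrix, J1, X1, Matrix.mul_apply, Fin.sum_univ_four, Matrix.vecHead,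
      Matrix.vecTail]

/-- The columns are `p, -ip, q, -iq`. As `i` is a skew isometry, the four hypotheses already make
them pseudo-orthonormal; then `ε Aᵀ ε` is a left inverse of `A`. -/
theorem antilinearMatrix_mem_O24 {p q : Vec4} (hp : inner22 p p = 1) (hq : inner22 q q = -1)
    (hpq : inner22 p q = 0) (hpX : inner22 p (X1 q) = 0) : antilinearMatrix p q ∈ O24 := by
  have hε : epsilon * epsilon = 1 := by
    rw [epsilon, Matrix.diagonal_mul_diagonal, ← Matrix.diagonal_one]
    congr 1
    ext i; fin_cases i <;> simp
  have key : (antilinearMatrix p q)ᵀ * epsilon * antilinearMatrix p q = epsilon := by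
    simp only [inner22, X1, Matrix.cons_val] at hp hq hpq hpX
    ext i j
    fin_cases i <;> fin_cases j <;>
      simp [antilinearMatrix, epsilon, X1, Matrix.mul_apply, Fin.sum_univ_four,
        Matrix.diagonal_apply] <;> linarith
  have hinv : epsilon * (antilinearMatrix p q)ᵀ * epsilon * antilinearMatrix p q = 1 := by
    rw [Matrix.mul_assoc, Matrix.mul_assoc, ← Matrix.mul_assoc _ epsilon, key, hε]
  refine ⟨(Matrix.isUnit_iff_isUnit_det _).2 (Matrix.isUnit_det_of_left_inverse hinv), ?_⟩
  rw [Matrix.inv_eq_left_inv hinv]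
  calc (antilinearMatrix p q)ᵀ
      = (epsilon * epsilon) * (antilinearMatrix p q)ᵀ * (epsilon * epsilon) := by
        rw [hε, Matrix.one_mul, Matrix.mul_one]
    _ = _ := by simp only [Matrix.mul_assoc]

/-- A curve in `SL(2,ℝ)` solving `γ'' = b i γ' + a γ` with distinct characteristic frequencies
is the image of a standard curve under an antilinear isometry. -/
theorem exists_antilinear_isometry {I : Set ℝ} (hI : IsOpen I) (hc : IsConnected I)
    {γ v : ℝ → Vec4} {α₁ α₂ x B C₁ C₃ : ℝ}
    (hγ : ∀ s ∈ I, HasDerivAt γ (v s) s)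
    (hv : ∀ s ∈ I, HasDerivAt v ((-(α₁ + α₂)) • X1 (v s) + (α₁ * α₂) • γ s) s)
    (h1 : ∀ s ∈ I, inner22 (γ s) (γ s) = 1) (h2 : ∀ s ∈ I, inner22 (v s) (γ s) = 0)
    (h3 : ∀ s ∈ I, inner22 (v s) (v s) = B) (h4 : ∀ s ∈ I, inner22 (γ s) (X1 (v s)) = x)
    (hB : B = (α₁ + α₂) * x - α₁ * α₂) (h12 : 0 < α₁ - α₂) (hC₁ : C₁ < 0) (hC₃ : 0 < C₃)
    (hC₁' : C₁ * (α₁ ^ 2 - α₂ ^ 2) = B - α₂ ^ 2) (hC₃' : C₃ * (α₁ ^ 2 - α₂ ^ 2) = -B + α₁ ^ 2)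
    (hs : α₁ + α₂ ≠ 0) :
    ∃ A ∈ O24, A * J1 = -(J1 * A) ∧ ∀ s ∈ I, γ s = A.mulVec
      ![√C₃ * Real.cos (α₂ * s), √C₃ * Real.sin (α₂ * s),
        √(-C₁) * Real.cos (α₁ * s), √(-C₁) * Real.sin (α₁ * s)] := by
  have dX : ∀ s ∈ I, HasDerivAt (fun u => X1 (v u)) ((α₁ + α₂) • v s + (α₁ * α₂) • X1 (γ s)) s := by
    intro s hs
    refine (hasDerivAt_X1 (hv s hs)).congr_deriv ?_
    rw [X1_add, X1_smul, X1_smul, X1_X1]; module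
  -- `α₁γ - iγ'` and `iγ' - α₂γ` are the two frequency components of `γ`; their sum is `(α₁ - α₂)γ`.
  obtain ⟨p, hp⟩ := exists_rotating hI hc (P := fun s => α₁ • γ s - X1 (v s)) (α := α₂)
    (fun s hs => (((hγ s hs).const_smul α₁).sub (dX s hs)).congr_deriv (by
      rw [X1_sub, X1_smul, X1_X1]; module))
  obtain ⟨q, hq⟩ := exists_rotating hI hc (P := fun s => X1 (v s) - α₂ • γ s) (α := α₁)
    (fun s hs => ((dX s hs).sub ((hγ s hs).const_smul α₂)).congr_deriv (by
      rw [X1_sub, X1_smul, X1_X1]; module))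
  have hn₁ : √C₃ ^ 2 = C₃ := Real.sq_sqrt hC₃.le
  have hn₂ : √(-C₁) ^ 2 = -C₁ := Real.sq_sqrt (by linarith)
  have p₁ : √C₃ ≠ 0 := (Real.sqrt_pos.2 hC₃).ne'
  have p₂ : √(-C₁) ≠ 0 := (Real.sqrt_pos.2 (by linarith)).ne'
  obtain ⟨s₀, hs₀⟩ := hc.nonempty
  have gen : ∀ (c d e f : ℝ) (P Q : Vec4), inner22 (c • P + d • X1 P) (e • Q + f • X1 Q)
      = (c * e + d * f) * inner22 P Q + (c * f - d * e) * inner22 P (X1 Q) := by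
    intro c d e f P Q
    simp [inner22, X1]; ring
  have gen2 : ∀ (c d e f : ℝ) (P Q : Vec4), inner22 (c • P + d • X1 P) (X1 (e • Q + f • X1 Q))
      = (c * e + d * f) * inner22 P (X1 Q) - (c * f - d * e) * inner22 P Q := by
    intro c d e f P Q
    simp [inner22, X1]; ring
  have skew : ∀ P, inner22 P (X1 P) = 0 := by intro P; simp only [inner22, X1, Matrix.cons_val]; ring
  have g1 := h1 s₀ hs₀
  have g2 := h2 s₀ hs₀
  have g3 := h3 s₀ hs₀
  have g4 := h4 s₀ hs₀
  have PP : inner22 (α₁ • γ s₀ - X1 (v s₀)) (α₁ • γ s₀ - X1 (v s₀)) = α₁ ^ 2 - 2 * α₁ * x + B := by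
    rw [← g3, ← g4, show α₁ ^ 2 = α₁ ^ 2 * 1 by ring, ← g1]
    simp [inner22, X1]; ring
  have QQ : inner22 (X1 (v s₀) - α₂ • γ s₀) (X1 (v s₀) - α₂ • γ s₀) = α₂ ^ 2 - 2 * α₂ * x + B := by
    rw [← g3, ← g4, show α₂ ^ 2 = α₂ ^ 2 * 1 by ring, ← g1]
    simp [inner22, X1]; ring
  have PQ : inner22 (α₁ • γ s₀ - X1 (v s₀)) (X1 (v s₀) - α₂ • γ s₀) = 0 := by
    have : inner22 (α₁ • γ s₀ - X1 (v s₀)) (X1 (v s₀) - α₂ • γ s₀)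
        = (α₁ + α₂) * inner22 (γ s₀) (X1 (v s₀)) - inner22 (v s₀) (v s₀)
          - α₁ * α₂ * inner22 (γ s₀) (γ s₀) := by
      simp [inner22, X1]; ring
    rw [this, g1, g3, g4, hB]; ring
  have PX : inner22 (α₁ • γ s₀ - X1 (v s₀)) (X1 (X1 (v s₀) - α₂ • γ s₀)) = 0 := by
    have : inner22 (α₁ • γ s₀ - X1 (v s₀)) (X1 (X1 (v s₀) - α₂ • γ s₀))
        = (α₂ - α₁) * inner22 (v s₀) (γ s₀) := by
      simp [inner22, X1]; ring
    rw [this, g2, mul_zero]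
  have cs := fun y => Real.sin_sq_add_cos_sq y
  have hpp : inner22 p p = (α₁ - α₂) ^ 2 * C₃ := by
    rw [← hp s₀ hs₀, gen, PP, skew]
    -- `hB` determines `x` only through `(α₁ + α₂)x`, so that factor is introduced and cancelled.
    apply mul_right_cancel₀ hs
    linear_combination (α₁ ^ 2 - 2 * α₁ * x + B) * (α₁ + α₂) * cs (α₂ * s₀)
      - (α₁ - α₂) * hC₃' + 2 * α₁ * hB
  have hqq : inner22 q q = (α₁ - α₂) ^ 2 * C₁ := by
    rw [← hq s₀ hs₀, gen, QQ, skew]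
    apply mul_right_cancel₀ hs
    linear_combination (α₂ ^ 2 - 2 * α₂ * x + B) * (α₁ + α₂) * cs (α₁ * s₀)
      - (α₁ - α₂) * hC₁' + 2 * α₂ * hB
  have hpq : inner22 p q = 0 := by
    rw [← hp s₀ hs₀, ← hq s₀ hs₀, gen, PQ, PX]; ring
  have hpX : inner22 p (X1 q) = 0 := by
    rw [← hp s₀ hs₀, ← hq s₀ hs₀, gen2, PQ, PX]; ring
  have sl : ∀ (c d : ℝ) v w, inner22 (c • v) (d • w) = c * d * inner22 v w := by
    intro c d v w; simp only [inner22, Pi.smul_apply, smul_eq_mul]; ring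
  have hδ : α₁ - α₂ ≠ 0 := h12.ne'
  -- `p` and `q` are scaled to norms `1` and `-1`.
  refine ⟨antilinearMatrix (((α₁ - α₂) * √C₃)⁻¹ • p) (((α₁ - α₂) * √(-C₁))⁻¹ • q),
    antilinearMatrix_mem_O24 ?_ ?_ ?_ ?_, antilinearMatrix_mul_J1 _ _, fun s hs => ?_⟩
  · rw [sl, hpp]; field_simp; rw [hn₁]
  · rw [sl, hqq]; field_simp; rw [hn₂]; ring
  · rw [sl, hpq, mul_zero]
  · rw [X1_smul, sl, hpX, mul_zero]
  · rw [antilinearMatrix_mulVec]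
    simp only [Matrix.cons_val, X1_smul, smul_smul]
    have i₁ : ∀ y, √C₃ * y * ((α₁ - α₂) * √C₃)⁻¹ = (α₁ - α₂)⁻¹ * y := by
      intro y; field_simp
    have i₂ : ∀ y, √(-C₁) * y * ((α₁ - α₂) * √(-C₁))⁻¹ = (α₁ - α₂)⁻¹ * y := by
      intro y; field_simp
    rw [i₁, i₁, i₂, i₂]
    have inv : ∀ (y : ℝ) (P : Vec4), Real.cos y • (Real.cos y • P + Real.sin y • X1 P)
        - Real.sin y • X1 (Real.cos y • P + Real.sin y • X1 P) = P := by
      intro y P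
      rw [X1_add, X1_smul, X1_smul, X1_X1]
      have : (Real.sin y ^ 2 + Real.cos y ^ 2) • P = P := by rw [cs, one_smul]
      conv_rhs => rw [← this]
      module
    have e₁ := inv (α₂ * s) (α₁ • γ s - X1 (v s))
    have e₂ := inv (α₁ * s) (X1 (v s) - α₂ • γ s)
    rw [hp s hs] at e₁
    rw [hq s hs] at e₂
    have e₃ : (α₁ - α₂)⁻¹ • ((α₁ • γ s - X1 (v s)) + (X1 (v s) - α₂ • γ s)) = γ s := by
      rw [show (α₁ • γ s - X1 (v s)) + (X1 (v s) - α₂ • γ s) = (α₁ - α₂) • γ s by module,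
        smul_smul, inv_mul_cancel₀ hδ, one_smul]
    rw [← e₁, ← e₂] at e₃
    rw [← e₃]
    module

/-! ### From angle data to the linear equation -/

namespace IsAngleData

variable {τ ϑ b : ℝ} {I : Set ℝ} {γ : ℝ → Vec4} {β : ℝ → ℝ}

theorem deriv_eq_field (D : IsAngleData τ I γ ϑ b β) {s : ℝ} (hs : s ∈ I) : deriv γ s
    = field τ ![Real.cos ϑ, Real.sin ϑ * Real.sin (β s), Real.sin ϑ * Real.cos (β s)] (γ s) := by
  rw [D.tangent s hs]
  simp [field, Fin.sum_univ_three]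

theorem hasDerivAt_phase (D : IsAngleData τ I γ ϑ b β) (hI : IsOpen I) {s : ℝ} (hs : s ∈ I) :
    HasDerivAt β b s := by
  rw [← D.deriv_phase s hs]
  exact ((D.smooth.contDiffAt (hI.mem_nhds hs)).differentiableAt (by simp)).hasDerivAt

theorem cos_nonneg (D : IsAngleData τ I γ ϑ b β) : 0 ≤ Real.cos ϑ :=
  Real.cos_nonneg_of_mem_Icc ⟨by linarith [D.angle_mem.1, Real.pi_pos], D.angle_mem.2⟩

theorem cos_lt_one (D : IsAngleData τ I γ ϑ b β) : Real.cos ϑ < 1 := by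
  rw [← Real.cos_zero]
  exact Real.cos_lt_cos_of_nonneg_of_le_pi le_rfl
    (by linarith [D.angle_mem.2, Real.pi_pos]) D.angle_mem.1

theorem velocity_eq (D : IsAngleData τ I γ ϑ b β) (hτ : 0 < τ) (hγ : IsProperBiharmonic τ I γ)
    {s : ℝ} (hs : s ∈ I) : velocity τ γ s
      = ![Real.cos ϑ, Real.sin ϑ * Real.sin (β s), Real.sin ϑ * Real.cos (β s)] := by
  rw [velocity, D.deriv_eq_field hs, coords_field hτ (hγ.mem s hs)]

/-- The angle and the phase speed satisfy the biharmonic relation. -/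
theorem relation (D : IsAngleData τ I γ ϑ b β) (hτ : 0 < τ) (hI : IsOpen I)
    (hγ : IsProperBiharmonic τ I γ) : (b + τ⁻¹ * (2 + τ ^ 2) * Real.cos ϑ) ^ 2
      = (4 + 5 * τ ^ 2) * Real.cos ϑ ^ 2 - 4 * (1 + τ ^ 2) := by
  have hv : ∀ s ∈ I, velocity τ γ s
      = ![Real.cos ϑ, Real.sin ϑ * Real.sin (β s), Real.sin ϑ * Real.cos (β s)] :=
    fun s hs => D.velocity_eq hτ hγ hs
  refine (hγ.isBiharmonicFrame hτ hI).rotation_relation hτ hI hγ.exists_tension_ne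
    (fun s hs => by rw [hv s hs]; rfl) (fun s hs => ?_) (fun s hs => ?_)
  · refine (((D.hasDerivAt_phase hI hs).sin.const_mul (Real.sin ϑ)).congr_of_eventuallyEq
      (by filter_upwards [hI.mem_nhds hs] with u hu; rw [hv u hu]; rfl)).congr_deriv ?_
    rw [hv s hs]; simp only [Matrix.cons_val]; ring
  · refine (((D.hasDerivAt_phase hI hs).cos.const_mul (Real.sin ϑ)).congr_of_eventuallyEq
      (by filter_upwards [hI.mem_nhds hs] with u hu; rw [hv u hu]; rfl)).congr_deriv ?_
    rw [hv s hs]; simp only [Matrix.cons_val]; ring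

/-- The second-order linear equation `γ'' = b i γ' + a γ`. -/
theorem hasDerivAt_deriv (D : IsAngleData τ I γ ϑ b β) (hI : IsOpen I)
    (hγ : IsProperBiharmonic τ I γ) {s : ℝ} (hs : s ∈ I) :
    HasDerivAt (deriv γ) (b • X1 (deriv γ s) + aConst τ ϑ b • γ s) s := by
  have g := hγ.hasDerivAt_apply hI hs
  have dβ := D.hasDerivAt_phase hI hs
  have e : deriv γ =ᶠ[nhds s] fun u => field τ
      ![Real.cos ϑ, Real.sin ϑ * Real.sin (β u), Real.sin ϑ * Real.cos (β u)] (γ u) := by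
    filter_upwards [hI.mem_nhds hs] with u hu using D.deriv_eq_field hu
  refine HasDerivAt.congr_of_eventuallyEq ?_ e
  rw [D.deriv_eq_field hs] at g ⊢
  simp only [field_apply, Matrix.cons_val] at g ⊢
  have e1 := Real.sin_sq_add_cos_sq (β s)
  have e2 := Real.sin_sq_add_cos_sq ϑ
  have d1 := dβ.sin.const_mul (Real.sin ϑ)
  have d2 := dβ.cos.const_mul (Real.sin ϑ)
  have ha := aConst_eq τ ϑ b
  rw [bTilde, ← inv_pow] at ha
  have g0 := g 0
  have g1 := g 1
  have g2 := g 2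
  have g3 := g 3
  refine hasDerivAt_pi.2 fun k => ?_
  fin_cases k
  · refine ((((g1.const_mul τ⁻¹).const_mul (Real.cos ϑ)).add (d1.mul g3)).add
      (d2.mul g2)).congr_deriv ?_
    simp [ha, X1]
    linear_combination γ s 0 * Real.sin ϑ ^ 2 * e1 + γ s 0 * e2
  · refine ((((g0.const_mul τ⁻¹).const_mul (Real.cos ϑ)).neg.add (d1.mul g2)).sub
      (d2.mul g3)).congr_deriv ?_
    simp [ha, X1]
    linear_combination γ s 1 * Real.sin ϑ ^ 2 * e1 + γ s 1 * e2
  · refine ((((g3.const_mul τ⁻¹).const_mul (Real.cos ϑ)).add (d1.mul g1)).add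
      (d2.mul g0)).congr_deriv ?_
    simp [ha, X1]
    linear_combination γ s 2 * Real.sin ϑ ^ 2 * e1 + γ s 2 * e2
  · refine ((((g2.const_mul τ⁻¹).const_mul (Real.cos ϑ)).neg.add (d1.mul g0)).sub
      (d2.mul g1)).congr_deriv ?_
    simp [ha, X1]
    linear_combination γ s 3 * Real.sin ϑ ^ 2 * e1 + γ s 3 * e2

theorem inner_deriv_self (D : IsAngleData τ I γ ϑ b β) (hγ : IsProperBiharmonic τ I γ) {s : ℝ}
    (hs : s ∈ I) : inner22 (deriv γ s) (deriv γ s) = bTilde τ ϑ := by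
  have h : inner22 (γ s) (γ s) = 1 := hγ.mem s hs
  rw [D.deriv_eq_field hs, inner_field_self, h, bTilde, ← inv_pow]
  simp only [Matrix.cons_val]
  linear_combination -Real.sin ϑ ^ 2 * Real.sin_sq_add_cos_sq (β s) - Real.sin_sq_add_cos_sq ϑ

theorem inner_X1_deriv (D : IsAngleData τ I γ ϑ b β) (hγ : IsProperBiharmonic τ I γ) {s : ℝ}
    (hs : s ∈ I) : inner22 (γ s) (X1 (deriv γ s)) = τ⁻¹ * Real.cos ϑ := by
  have h : inner22 (γ s) (γ s) = 1 := hγ.mem s hs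
  rw [D.deriv_eq_field hs, inner_X1_field, h, mul_one]; rfl

end IsAngleData

end SLTwo

end

/-! ### Assembly of the theorem -/

theorem mainTheorem6 (τ : ℝ) (hτ : 0 < τ) (I : Set ℝ) (hIopen : IsOpen I) (hIconn : IsConnected I)
    (γ : ℝ → SLTwo.Vec4) (hγ : SLTwo.IsProperBiharmonic τ I γ)
    (horient : ∀ s ∈ I, 0 ≤ SLTwo.metric τ (γ s) (deriv γ s) (SLTwo.frame τ 0 (γ s))) :
    (∃ (ϑ b : ℝ) (β : ℝ → ℝ), SLTwo.IsAngleData τ I γ ϑ b β) ∧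
    ∀ (ϑ b : ℝ) (β : ℝ → ℝ) (a : ℝ), SLTwo.IsAngleData τ I γ ϑ b β →
      a = SLTwo.aConst τ ϑ b → b ^ 2 > 4 * a →
      ((b = -τ⁻¹ * (2 + τ ^ 2) * Real.cos ϑ
              + √((4 + 5 * τ ^ 2) * Real.cos ϑ ^ 2 - 4 * (1 + τ ^ 2)) ∧
          4 * (1 + τ ^ 2) / (4 + 5 * τ ^ 2) ≤ Real.cos ϑ ^ 2 ∧
          Real.cos ϑ ^ 2 < (2 + τ ^ 2) ^ 2 / (4 + 5 * τ ^ 2 + τ ^ 4)) ∨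
        (b = -τ⁻¹ * (2 + τ ^ 2) * Real.cos ϑ
              - √((4 + 5 * τ ^ 2) * Real.cos ϑ ^ 2 - 4 * (1 + τ ^ 2)) ∧
          4 * (1 + τ ^ 2) / (4 + 5 * τ ^ 2) ≤ Real.cos ϑ ^ 2)) ∧
      0 < SLTwo.alpha2 a b ∧ SLTwo.alpha2 a b < SLTwo.alpha1 a b ∧
      SLTwo.c11 τ ϑ a b < 0 ∧ 0 < SLTwo.c33 τ ϑ a b ∧
      ∃ A ∈ SLTwo.O24, A * SLTwo.J1 = -(SLTwo.J1 * A) ∧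
        ∀ s ∈ I, γ s = A.mulVec
          ![√(SLTwo.c33 τ ϑ a b) * Real.cos (SLTwo.alpha2 a b * s),
            √(SLTwo.c33 τ ϑ a b) * Real.sin (SLTwo.alpha2 a b * s),
            √(-SLTwo.c11 τ ϑ a b) * Real.cos (SLTwo.alpha1 a b * s),
            √(-SLTwo.c11 τ ϑ a b) * Real.sin (SLTwo.alpha1 a b * s)] := by
  refine ⟨hγ.exists_angleData hτ hIopen hIconn horient, fun ϑ b β a D ha hΔ => ?_⟩
  have hc0 := D.cos_nonneg
  have hc1 := D.cos_lt_one
  have hrel := D.relation hτ hIopen hγ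
  obtain ⟨hc, hb⟩ := SLTwo.rotation_lt hτ hc0 hc1 hrel
  have haB : a = -SLTwo.bTilde τ ϑ - τ⁻¹ * Real.cos ϑ * b := ha.trans (SLTwo.aConst_eq τ ϑ b)
  have hi : 0 < τ⁻¹ := inv_pos.2 hτ
  have hx : 0 < τ⁻¹ * Real.cos ϑ := mul_pos hi hc
  have hb0 : b < 0 := by linarith
  have hBt : SLTwo.bTilde τ ϑ = (τ⁻¹ * Real.cos ϑ) ^ 2 - (1 - Real.cos ϑ ^ 2) := by
    rw [SLTwo.bTilde, ← inv_pow]; ring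
  have hsin : 0 < 1 - Real.cos ϑ ^ 2 := by nlinarith
  -- With `x = τ⁻¹ cos ϑ` and `b < -2x`, `a = -B̃ - xb > -B̃ + 2x² = x² + sin²ϑ`.
  have ha0 : 0 < a := by
    rw [haB, hBt]
    nlinarith [mul_lt_mul_of_pos_left hb hx]
  obtain ⟨hα₂, hα, hsum, hprod⟩ := SLTwo.alpha_facts hb0 ha0 hΔ
  set α₁ := SLTwo.alpha1 a b
  set α₂ := SLTwo.alpha2 a b
  have hsq : 0 < α₁ ^ 2 - α₂ ^ 2 := by nlinarith
  -- `B̃ < α₂²` is obtained without solving for the roots: the factors `αᵢ² - B̃` have positive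
  -- product `b² sin²ϑ` and positive sum `-b(-2x - b)`, so both are positive.
  have hf : (α₂ ^ 2 - SLTwo.bTilde τ ϑ) * (α₁ ^ 2 - SLTwo.bTilde τ ϑ)
      = b ^ 2 * (1 - Real.cos ϑ ^ 2) := by
    have e1 : α₁ ^ 2 + α₂ ^ 2 = b ^ 2 - 2 * a := by
      linear_combination (α₁ + α₂ - b) * hsum - 2 * hprod
    have e2 : α₁ ^ 2 * α₂ ^ 2 = a ^ 2 := by rw [← hprod]; ring
    linear_combination e2 - SLTwo.bTilde τ ϑ * e1 + (a + SLTwo.bTilde τ ϑ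
      - τ⁻¹ * Real.cos ϑ * b) * haB - b ^ 2 * hBt
  have hf0 : 0 < (α₂ ^ 2 - SLTwo.bTilde τ ϑ) * (α₁ ^ 2 - SLTwo.bTilde τ ϑ) := by
    rw [hf]; exact mul_pos (sq_pos_of_neg hb0) hsin
  have hmean : 0 < (α₂ ^ 2 - SLTwo.bTilde τ ϑ) + (α₁ ^ 2 - SLTwo.bTilde τ ϑ) := by
    have e1 : (α₂ ^ 2 - SLTwo.bTilde τ ϑ) + (α₁ ^ 2 - SLTwo.bTilde τ ϑ)
        = -b * (-(2 * τ⁻¹ * Real.cos ϑ) - b) := by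
      linear_combination (α₁ + α₂ - b) * hsum - 2 * hprod - 2 * haB
    rw [e1]; exact mul_pos (by linarith) (by linarith)
  have hB₂ : SLTwo.bTilde τ ϑ < α₂ ^ 2 := by
    by_contra hle
    nlinarith
  have hC₁ : SLTwo.c11 τ ϑ a b < 0 := div_neg_of_neg_of_pos (by linarith) hsq
  have hC₃ : 0 < SLTwo.c33 τ ϑ a b := div_pos (by linarith) hsq
  have hrel0 : 0 ≤ (4 + 5 * τ ^ 2) * Real.cos ϑ ^ 2 - 4 * (1 + τ ^ 2) := hrel ▸ sq_nonneg _
  have hlow : 4 * (1 + τ ^ 2) / (4 + 5 * τ ^ 2) ≤ Real.cos ϑ ^ 2 := by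
    rw [div_le_iff₀ (by positivity)]; linarith
  refine ⟨?_, hα₂, hα, hC₁, hC₃, ?_⟩
  -- The square root equals `|b + τ⁻¹(2+τ²) cos ϑ|`; the sign inside decides between (i) and (ii).
  · rw [← hrel, Real.sqrt_sq_eq_abs]
    rcases le_total 0 (b + τ⁻¹ * (2 + τ ^ 2) * Real.cos ϑ) with h | h
    · left
      refine ⟨by rw [abs_of_nonneg h]; ring, hlow,
        SLTwo.cos_sq_lt hτ hc hc1 hrel (by linarith) ?_⟩
      rw [haB, SLTwo.bTilde] at hΔ
      linarith
    · right
      exact ⟨by rw [abs_of_nonpos h]; ring, hlow⟩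
  · refine SLTwo.exists_antilinear_isometry hIopen hIconn
      (fun s hs => hγ.hasDerivAt hIopen hs) (fun s hs => ?_) (fun s hs => hγ.mem s hs)
      (fun s hs => hγ.inner_deriv hIopen hs) (fun s hs => D.inner_deriv_self hγ hs)
      (fun s hs => D.inner_X1_deriv hγ hs) ?_ (sub_pos.2 hα) hC₁ hC₃
      (div_mul_cancel₀ _ hsq.ne') (div_mul_cancel₀ _ hsq.ne') (by linarith)
    · rw [hsum, hprod, neg_neg, ha]
      exact D.hasDerivAt_deriv hIopen hγ hs
    · rw [hsum, hprod]; linarith
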